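/- A straight-line program over $\mathrm{GF}(2)$ works on a memory whose cells hold elements of $\mathrm{GF}(2)$ and initially contain the input bits. It is a finite list of bit operations, each of which adds two earlier cells in $\mathrm{GF}(2)$, multiplies two earlier cells in $\mathrm{GF}(2)$, or produces a fixed bit, and writes the result to a new cell, together with a list of the cells that form the output. (A cell that has not been written reads as $0$.) The number of bit operations of the program is the length of its list of operations. An algorithm is a computable map $n\mapsto P_n$ that assigns to every natural number $n$ a straight-line program $P_n$, which is carried out on the inputs of size $n$; its cost in bit operations at size $n$ is the number of bit operations of $P_n$. **Theorem.** There is an algorithm $(P_n)_n$ such that for every $n$ and for any two polynomials $f,g$ of degree $<n$ over $\mathrm{GF}(2)$, the program $P_n$, given the coefficients $f_0,\dots,f_{n-1},g_0,\dots,g_{n-1}$, outputs the coefficients $h_0,\dots,h_{2n-2}$ of the product $h=fg$, and such that the number of bit operations of $P_n$ is $$O\bigl(n\,\log n\,(\log\log n)^2\bigr)\qquad (n\to\infty).$$ -/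

import Mathlib

open Polynomial Asymptotics Filter

namespace BitModel

/-- One bit operation. The operands `i`, `j` are addresses of memory cells, each holding an
element of GF(2). `add` is addition in GF(2) (exclusive or), `mul` is multiplication in GF(2)
(logical and), and `const` writes a fixed bit. -/
inductive BitOp where
  | const (b : Bool)
  | add (i j : ℕ)
  | mul (i j : ℕ)

/-- A `BitOp` is a fixed bit or a tagged pair of addresses. -/
def BitOp.equiv : BitOp ≃ Bool ⊕ (Bool × ℕ × ℕ) where
  toFun
    | .const b => .inl b
    | .add i j => .inr (false, i, j)
    | .mul i j => .inr (true, i, j)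
  invFun
    | .inl b => .const b
    | .inr (false, i, j) => .add i j
    | .inr (true, i, j) => .mul i j
  left_inv := by rintro (b | ⟨i, j⟩ | ⟨i, j⟩) <;> rfl
  right_inv := by rintro (b | ⟨_ | _, i, j⟩) <;> rfl

/-- Bit operations are finite data, so that one can speak of computing them. -/
instance : Primcodable BitOp := Primcodable.ofEquiv _ BitOp.equiv

/-- The bit produced by one operation on the memory `mem`. A cell that has not been written yet
reads as `0`. -/
def BitOp.eval (mem : List (ZMod 2)) : BitOp → ZMod 2
  | .const b => if b then 1 else 0
  | .add i j => mem.getD i 0 + mem.getD j 0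
  | .mul i j => mem.getD i 0 * mem.getD j 0

/-- A straight-line program over GF(2): a list of bit operations, and the addresses of the cells
in which the output bits are found, in order, at the end. -/
structure Program where
  code : List BitOp
  out : List ℕ

/-- A program is a pair of lists. -/
def Program.equiv : Program ≃ List BitOp × List ℕ where
  toFun P := (P.code, P.out)
  invFun p := ⟨p.1, p.2⟩
  left_inv _ := rfl
  right_inv _ := rfl

/-- Programs are finite data, so that one can speak of computing them. -/
instance : Primcodable Program := Primcodable.ofEquiv _ Program.equiv

/-- Execute a list of operations in order. The memory initially holds the input bits, in cells
`0, 1, …`, and every operation writes its result to a new cell at the end of the memory. -/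
def exec (mem : List (ZMod 2)) (code : List BitOp) : List (ZMod 2) :=
  code.foldl (fun m o => m ++ [o.eval m]) mem

/-- The output of a program on a list of input bits. -/
def Program.run (P : Program) (input : List (ZMod 2)) : List (ZMod 2) :=
  P.out.map fun i => (exec input P.code).getD i 0

/-- The number of bit operations that a program performs (on every input). -/
def Program.cost (P : Program) : ℕ := P.code.length

/-- The list of the coefficients of `1, X, …, X ^ (k - 1)` in a polynomial over GF(2). -/
def coeffs (k : ℕ) (f : (ZMod 2)[X]) : List (ZMod 2) :=
  (List.range k).map f.coeff

/-- An algorithm that operates on bits and whose input comes in sizes `n : ℕ`: an effective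
procedure which, given `n`, determines the sequence of bit operations that is carried out on the
inputs of size `n`. -/
structure Algorithm where
  prog : ℕ → Program
  computable_prog : Computable prog

/-- The algorithm computes, for every `n` and every two polynomials `f`, `g` of degree `< n` over
GF(2), given by their `n` coefficients each, the `2 n - 1` coefficients of the product `f * g`.
(For `n = 0` the input and the output are empty.) -/
def Algorithm.MultipliesPolynomials (A : Algorithm) : Prop :=
  ∀ (n : ℕ) (f g : (ZMod 2)[X]), f.degree < n → g.degree < n →
    (A.prog n).run (coeffs n f ++ coeffs n g) = coeffs (2 * n - 1) (f * g)

/-- The number of bit operations of the algorithm on inputs of size `n`. -/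
def Algorithm.bitOps (A : Algorithm) (n : ℕ) : ℕ := (A.prog n).cost

end BitModel

/-! The algorithm is Schönhage's multiplication for characteristic 2. Since 2 is not invertible
there, the fast Fourier transform has radix 3, and the work takes place in `TriRing R k`, that is
`R[X] / (X ^ (2 * 3 ^ k) + X ^ 3 ^ k + 1)`. In it `X ^ (3 * 3 ^ k) = 1`, and `X ^ 3 ^ k` is a
primitive cube root of unity, so multiplying by a power of `X` is a rotation of coefficients
followed by linearly many additions.

For `a ≤ b`, cut elements of `TriRing R (a + b)` into `2 * 3 ^ a` blocks of length `3 ^ b`. This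
gives polynomials in `Y = X ^ 3 ^ b` over `TriRing R b`, to be multiplied modulo `Y ^ (2 * 3 ^ a) +
Y ^ 3 ^ a + 1`. All roots of unity needed are powers of `X`, so the transform (`mulMod_top`) leaves
`2 * 3 ^ a` products in `TriRing R b` and `O((a + 1) * 3 ^ (a + b))` further operations
(`triMul_add`). Taking `a` and `b` about `k / 2`, the cost divided by `3 ^ k` satisfies `c(k) ≤ 2
c(k / 2) + O(k)`, hence `c(k) = O(k log k)` (`triMul_succ`). With `3 ^ k` of order `n` this is `O(n
log n log log n)`, which is more than is claimed.

Costs are counted over an arbitrary nontrivial ring `R` of characteristic 2. If `R` consists of the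
functions from inputs to GF(2), one derivation in `R` is one program valid for all inputs
(`exists_program`). Computability then comes from search: correctness and cost of a program at size
`n` can be decided by testing all `2 ^ (2 * n)` inputs, so the first program that passes can be
found (`exists_computable_of_primrecRel`). -/

namespace BitModel

/-! ### Counting ring operations; representations of ring elements by cells. -/

/-- `Derives S c T`: starting from the elements of `S` and `0`, all elements of `T` can be obtained
by at most `c` additions and multiplications in the ring `R`. -/
inductive Derives {R : Type*} [CommRing R] : Set R → ℕ → Set R → Prop
  | refl {S T : Set R} {c : ℕ} (h : T ⊆ insert 0 S) : Derives S c T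
  | add {S T : Set R} {c : ℕ} {a b : R} (ha : a ∈ insert 0 S) (hb : b ∈ insert 0 S)
      (h : Derives (insert (a + b) S) c T) : Derives S (c + 1) T
  | mul {S T : Set R} {c : ℕ} {a b : R} (ha : a ∈ insert 0 S) (hb : b ∈ insert 0 S)
      (h : Derives (insert (a * b) S) c T) : Derives S (c + 1) T

namespace Derives

variable {R : Type*} [CommRing R] {S S' T T' U : Set R} {c d : ℕ}

theorem mono_left (h : Derives S c T) (hS : S ⊆ insert 0 S') : Derives S' c T := by
  induction h generalizing S' with
  | refl h => exact .refl (h.trans (Set.insert_subset (by simp) hS))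
  | add ha hb _ ih =>
    refine .add (Set.insert_subset (by simp) hS ha) (Set.insert_subset (by simp) hS hb) (ih ?_)
    rw [Set.insert_comm]
    exact Set.insert_subset_insert hS
  | mul ha hb _ ih =>
    refine .mul (Set.insert_subset (by simp) hS ha) (Set.insert_subset (by simp) hS hb) (ih ?_)
    rw [Set.insert_comm]
    exact Set.insert_subset_insert hS

theorem mono_right (h : Derives S c T) (hT : T' ⊆ insert 0 T) : Derives S c T' := by
  induction h with
  | refl h => exact .refl (hT.trans (Set.insert_subset (by simp) h))
  | add ha hb _ ih => exact .add ha hb (ih hT)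
  | mul ha hb _ ih => exact .mul ha hb (ih hT)

theorem mono_cost (h : Derives S c T) (hc : c ≤ d) : Derives S d T := by
  induction h generalizing d with
  | refl h => exact .refl h
  | add ha hb _ ih =>
    obtain ⟨e, rfl⟩ := Nat.exists_eq_add_of_le' (Nat.one_le_of_lt hc)
    exact .add ha hb (ih (by omega))
  | mul ha hb _ ih =>
    obtain ⟨e, rfl⟩ := Nat.exists_eq_add_of_le' (Nat.one_le_of_lt hc)
    exact .mul ha hb (ih (by omega))

/-- Memory is never erased, so the starting cells are still available at the end. -/
theorem union_self (h : Derives S c T) : Derives S c (S ∪ T) := by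
  induction h with
  | refl h => exact .refl (Set.union_subset (Set.subset_insert _ _) h)
  | add ha hb _ ih => exact .add ha hb (ih.mono_right (by grind))
  | mul ha hb _ ih => exact .mul ha hb (ih.mono_right (by grind))

theorem trans_union (h : Derives S c T) (h' : Derives (S ∪ T) d U) : Derives S (c + d) U := by
  induction h with
  | refl h =>
    exact (h'.mono_left (Set.union_subset (Set.subset_insert _ _) h)).mono_cost (by omega)
  | add ha hb _ ih =>
    rw [Nat.add_right_comm]
    exact .add ha hb (ih (h'.mono_left (by grind)))
  | mul ha hb _ ih =>
    rw [Nat.add_right_comm]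
    exact .mul ha hb (ih (h'.mono_left (by grind)))

theorem trans (h : Derives S c T) (h' : Derives T d U) : Derives S (c + d) U :=
  h.trans_union (h'.mono_left (by grind))

theorem union (h : Derives S c T) (h' : Derives S d U) : Derives S (c + d) (T ∪ U) :=
  h.trans_union ((h'.mono_left (S' := S ∪ T) (by grind)).union_self.mono_right (by grind))

theorem of_subset (h : T ⊆ S) : Derives S 0 T := .refl (h.trans (Set.subset_insert _ _))

theorem iUnion_range {T : ℕ → Set R} {N : ℕ} (h : ∀ i < N, Derives S c (T i)) :
    Derives S (N * c) (⋃ i < N, T i) := by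
  induction N with
  | zero => exact .refl (by simp)
  | succ N ih =>
    rw [Nat.succ_mul]
    refine ((ih fun i hi => h i (by omega)).union (h N (by omega))).mono_right ?_
    refine (Set.iUnion₂_subset fun i hi => ?_).trans (Set.subset_insert _ _)
    rcases Nat.lt_succ_iff_lt_or_eq.1 hi with hi | rfl
    · exact (Set.subset_iUnion₂ (s := fun i (_ : i < N) => T i) i hi).trans Set.subset_union_left
    · exact Set.subset_union_right

theorem add_singleton (a b : R) : Derives ({a} ∪ {b}) 1 {a + b} :=
  .add (a := a) (b := b) (by simp) (by simp) (.refl (c := 0) (by grind))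

theorem mul_singleton (a b : R) : Derives ({a} ∪ {b}) 1 {a * b} :=
  .mul (a := a) (b := b) (by simp) (by simp) (.refl (c := 0) (by grind))

end Derives

/-- A representation of the elements of a ring `A` by finitely or infinitely many memory cells with
contents in `R`, in which zero is represented by zeros and an addition costs at most `addCost`. -/
structure Repr (R A : Type*) [CommRing R] [CommRing A] where
  cells : A → Set R
  cells_zero : cells 0 ⊆ {0}
  addCost : ℕ
  derives_add : ∀ a b, Derives (cells a ∪ cells b) addCost (cells (a + b))

/-- Every element of `R` is represented by itself. -/
def Repr.self (R : Type*) [CommRing R] : Repr R R where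
  cells r := {r}
  cells_zero := subset_rfl
  addCost := 1
  derives_add := Derives.add_singleton

/-- The polynomial with coefficients `c 0, …, c (N - 1)`. -/
noncomputable def ofCoeffs {A : Type*} [CommRing A] (N : ℕ) (c : ℕ → A) : A[X] :=
  ∑ i ∈ Finset.range N, monomial i (c i)

theorem coeff_ofCoeffs {A : Type*} [CommRing A] (N : ℕ) (c : ℕ → A) (i : ℕ) :
    (ofCoeffs N c).coeff i = if i < N then c i else 0 := by
  simp [ofCoeffs, coeff_monomial]

theorem ofCoeffs_mem {A : Type*} [CommRing A] (N : ℕ) (c : ℕ → A) :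
    ofCoeffs N c ∈ degreeLT A N := by
  rw [mem_degreeLT, degree_lt_iff_coeff_zero]
  intro i hi
  rw [coeff_ofCoeffs, if_neg (by omega)]

theorem coeff_eq_zero_of_mem_degreeLT {A : Type*} [CommRing A] {N i : ℕ} {p : A[X]}
    (hp : p ∈ degreeLT A N) (hi : N ≤ i) : p.coeff i = 0 :=
  (degree_lt_iff_coeff_zero _ _).1 (mem_degreeLT.1 hp) i hi

theorem X_pow_mul_mem_degreeLT {A : Type*} [CommRing A] {N m : ℕ} {p : A[X]}
    (hp : p ∈ degreeLT A m) : X ^ N * p ∈ degreeLT A (N + m) := by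
  rw [mem_degreeLT, degree_lt_iff_coeff_zero]
  intro i hi
  rw [coeff_X_pow_mul', if_pos (by omega)]
  exact coeff_eq_zero_of_mem_degreeLT hp (by omega)

theorem C_mul_mem_degreeLT {A : Type*} [CommRing A] {N : ℕ} {p : A[X]} (w : A)
    (hp : p ∈ degreeLT A N) : C w * p ∈ degreeLT A N := by
  rw [← smul_eq_C_mul]
  exact Submodule.smul_mem _ _ hp

namespace Repr

variable {R A : Type*} [CommRing R] [CommRing A] (M : Repr R A)

/-- The cells of the coefficients of a polynomial. -/
def polyCells (p : A[X]) : Set R := ⋃ i, M.cells (p.coeff i)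

theorem cells_coeff_subset (p : A[X]) (i : ℕ) : M.cells (p.coeff i) ⊆ M.polyCells p :=
  Set.subset_iUnion (fun i => M.cells (p.coeff i)) i

theorem cells_zero_subset (S : Set R) : M.cells 0 ⊆ insert 0 S :=
  M.cells_zero.trans (by simp)

theorem polyCells_subset_of_coeff {p : A[X]} {S : Set R}
    (h : ∀ i, M.cells (p.coeff i) ⊆ S) : M.polyCells p ⊆ S := Set.iUnion_subset h

theorem polyCells_subset {p : A[X]} {N : ℕ} (hp : p ∈ degreeLT A N) :
    M.polyCells p ⊆ insert 0 (⋃ i < N, M.cells (p.coeff i)) := by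
  refine M.polyCells_subset_of_coeff fun i => ?_
  by_cases hi : i < N
  · exact (Set.subset_iUnion₂ (s := fun i (_ : i < N) => M.cells (p.coeff i)) i hi).trans
      (Set.subset_insert _ _)
  · rw [coeff_eq_zero_of_mem_degreeLT hp (by omega)]
    exact M.cells_zero_subset _

theorem derives_polyCells {p : A[X]} {N c : ℕ} {S : Set R} (hp : p ∈ degreeLT A N)
    (h : ∀ i < N, Derives S c (M.cells (p.coeff i))) : Derives S (N * c) (M.polyCells p) :=
  (Derives.iUnion_range h).mono_right (M.polyCells_subset hp)

theorem derives_polyCells_add {p q : A[X]} {N c d : ℕ} {S : Set R} (hp : p ∈ degreeLT A N)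
    (hq : q ∈ degreeLT A N) (hc : Derives S c (M.polyCells p)) (hd : Derives S d (M.polyCells q)) :
    Derives S (c + d + N * M.addCost) (M.polyCells (p + q)) := by
  refine (hc.union hd).trans (M.derives_polyCells (add_mem hp hq) fun i _ => ?_)
  rw [coeff_add]
  exact (M.derives_add _ _).mono_left ((Set.union_subset_union (M.cells_coeff_subset p i)
    (M.cells_coeff_subset q i)).trans (Set.subset_insert _ _))

theorem derives_polyCells_C_mul {p : A[X]} {w : A} {N c γ : ℕ} {S : Set R}
    (hw : ∀ a, Derives (M.cells a) γ (M.cells (w * a))) (hp : p ∈ degreeLT A N)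
    (hc : Derives S c (M.polyCells p)) :
    Derives S (c + N * γ) (M.polyCells (C w * p)) := by
  refine hc.trans (M.derives_polyCells (C_mul_mem_degreeLT w hp) fun i _ => ?_)
  rw [coeff_C_mul]
  exact (hw _).mono_left ((M.cells_coeff_subset p i).trans (Set.subset_insert _ _))

theorem polyCells_ofCoeffs_subset {N : ℕ} {c : ℕ → A} {S : Set R}
    (h : ∀ i < N, M.cells (c i) ⊆ insert 0 S) : M.polyCells (ofCoeffs N c) ⊆ insert 0 S := by
  refine M.polyCells_subset_of_coeff fun i => ?_
  rw [coeff_ofCoeffs]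
  split_ifs with hi
  · exact h i hi
  · exact M.cells_zero_subset S

/-- Cutting a polynomial only selects coefficients, so it needs no operations. -/
theorem exists_split {p : A[X]} {N m : ℕ} (hp : p ∈ degreeLT A (N + m)) :
    ∃ p₀ ∈ degreeLT A N, ∃ p₁ ∈ degreeLT A m, p = p₀ + X ^ N * p₁ ∧
      M.polyCells p₀ ⊆ insert 0 (M.polyCells p) ∧ M.polyCells p₁ ⊆ insert 0 (M.polyCells p) := by
  refine ⟨ofCoeffs N p.coeff, ofCoeffs_mem _ _, ofCoeffs m fun i => p.coeff (i + N),
    ofCoeffs_mem _ _, ?_, ?_, ?_⟩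
  · ext i
    rw [coeff_add, coeff_X_pow_mul', coeff_ofCoeffs, coeff_ofCoeffs]
    by_cases hi : i < N
    · simp [hi, not_le.2 hi]
    · rw [if_neg hi, if_pos (not_lt.1 hi), zero_add, Nat.sub_add_cancel (not_lt.1 hi)]
      split_ifs with h
      · rfl
      · exact coeff_eq_zero_of_mem_degreeLT hp (by omega)
  all_goals
    exact M.polyCells_ofCoeffs_subset fun i _ =>
      (M.cells_coeff_subset p _).trans (Set.subset_insert _ _)

theorem polyCells_join_subset {p₀ p₁ : A[X]} {N : ℕ} (hp : p₀ ∈ degreeLT A N) :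
    M.polyCells (p₀ + X ^ N * p₁) ⊆ M.polyCells p₀ ∪ M.polyCells p₁ := by
  refine M.polyCells_subset_of_coeff fun i => ?_
  rw [coeff_add, coeff_X_pow_mul']
  split_ifs with hi
  · rw [coeff_eq_zero_of_mem_degreeLT hp hi, zero_add]
    exact (M.cells_coeff_subset p₁ _).trans Set.subset_union_right
  · rw [add_zero]
    exact (M.cells_coeff_subset p₀ _).trans Set.subset_union_left

end Repr

end BitModel

/-! ### Radix-3 fast Fourier transform in characteristic 2. -/

namespace BitModel

theorem two_eq_zero {A : Type*} [CommRing A] [CharP A 2] : (2 : A) = 0 := by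
  exact_mod_cast CharP.cast_eq_zero A 2

/-- With `U = D⁻¹`, the factor `1 + U * Y + U ^ 2 * Y ^ 2` is `U ^ 2` times the cofactor `Y ^ 2 + D
* Y + D ^ 2` of `Y - D` in `Y ^ 3 - D ^ 3`. -/
theorem cube_sub_cube_dvd {B : Type*} [CommRing B] {Y D U x : B} (hU : D * U = 1)
    (h : Y - D ∣ x) : Y ^ 3 - D ^ 3 ∣ (1 + U * Y + U ^ 2 * Y ^ 2) * x := by
  obtain ⟨k, rfl⟩ := h
  exact ⟨U ^ 2 * k, by linear_combination (D * (1 + U * D) - U * Y ^ 2 - Y) * k * hU⟩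

/-- Chinese remaindering at the nodes `D`, `D * W`, `D * W ^ 2`, with inverses `U`, `U * W ^ 2`, `U
* W`. The three cofactors from `cube_sub_cube_dvd` sum to 3, which is 1 in characteristic 2, so no
division by 3 is needed. -/
theorem dvd_interpolate_three {B : Type*} [CommRing B] {Y D U W r₀ r₁ r₂ f : B} (h2 : (2 : B) = 0)
    (hU : D * U = 1) (hW : W ^ 2 + W + 1 = 0) (h₀ : Y - D ∣ r₀ - f) (h₁ : Y - D * W ∣ r₁ - f)
    (h₂ : Y - D * W ^ 2 ∣ r₂ - f) :
    Y ^ 3 - D ^ 3 ∣ r₀ + (r₁ + r₂) + Y * (U * r₀ + (U * W ^ 2 * r₁ + U * W * r₂) +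
      Y * (U ^ 2 * r₀ + ((U * W ^ 2) ^ 2 * r₁ + (U * W) ^ 2 * r₂))) - f := by
  have hW3 : W ^ 3 = 1 := by linear_combination (W - 1) * hW
  have e₀ := cube_sub_cube_dvd hU h₀
  have e₁ := cube_sub_cube_dvd (U := U * W ^ 2)
    (by linear_combination hU + D * U * hW3) h₁
  have e₂ := cube_sub_cube_dvd (U := U * W)
    (by linear_combination hU + D * U * hW3) h₂
  rw [show (D * W) ^ 3 = D ^ 3 by linear_combination D ^ 3 * hW3] at e₁
  rw [show (D * W ^ 2) ^ 3 = D ^ 3 by linear_combination D ^ 3 * (W ^ 3 + 1) * hW3] at e₂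
  convert dvd_add e₀ (dvd_add e₁ e₂) using 1
  linear_combination f * h2 + (U * Y + U ^ 2 * Y ^ 2 * (W ^ 2 - W + 1)) * f * hW

/-- Lagrange interpolation at `W` and `W ^ 2`; the denominators are `±(W - W ^ 2)`, equal to 1 in
characteristic 2. -/
theorem dvd_interpolate_two {B : Type*} [CommRing B] {Y W r₁ r₂ f : B} (h2 : (2 : B) = 0)
    (hW : W ^ 2 + W + 1 = 0) (h₁ : Y - W ∣ r₁ - f) (h₂ : Y - W ^ 2 ∣ r₂ - f) :
    Y ^ 2 + Y + 1 ∣ W ^ 2 * r₁ + W * r₂ + Y * (r₁ + r₂) - f := by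
  obtain ⟨k₁, hk₁⟩ := h₁
  obtain ⟨k₂, hk₂⟩ := h₂
  refine ⟨k₁ + k₂, ?_⟩
  linear_combination (Y + W ^ 2) * hk₁ + (Y + W) * hk₂ +
    (-(Y * W + Y + 1) * k₁ + (W * Y - 1) * k₂ + (Y - 1) * f) * h2 +
    ((Y - W + 1) * k₁ + (1 - W - Y) * k₂ + f) * hW

namespace Repr

variable {R A : Type*} [CommRing R] [CommRing A] (M : Repr R A)

/-- Polynomials with `N` coefficients can be multiplied modulo `F` at cost `c`. -/
def MulMod (F : A[X]) (N c : ℕ) : Prop :=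
  ∀ p ∈ degreeLT A N, ∀ q ∈ degreeLT A N, ∃ r ∈ degreeLT A N, F ∣ r - p * q ∧
    Derives (M.polyCells p ∪ M.polyCells q) c (M.polyCells r)

/-- Additions and multiplications by powers of `ω` cost at most `γ`, and `ω ^ L` is a primitive
third root of unity. -/
structure CheapRoot (ω : A) (L γ : ℕ) : Prop where
  addCost_le : M.addCost ≤ γ
  derives_pow_mul : ∀ s a, Derives (M.cells a) γ (M.cells (ω ^ s * a))
  root : ω ^ (2 * L) + ω ^ L + 1 = 0
  pos : 0 < L

theorem mulMod_one (F : A[X]) {μ : ℕ}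
    (hmul : ∀ a b, Derives (M.cells a ∪ M.cells b) μ (M.cells (a * b))) : M.MulMod F 1 μ := by
  intro p hp q hq
  have key : ∀ p ∈ degreeLT A 1, p = C (p.coeff 0) := fun p hp => by
    ext i
    rw [coeff_C]
    split_ifs with hi
    · rw [hi]
    · exact coeff_eq_zero_of_mem_degreeLT hp (by omega)
  have hr : C (p.coeff 0 * q.coeff 0) ∈ degreeLT A 1 := by
    rw [mem_degreeLT, degree_lt_iff_coeff_zero]
    intro i hi
    rw [coeff_C, if_neg (by omega)]
  refine ⟨C (p.coeff 0 * q.coeff 0), hr, ?_, ?_⟩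
  · rw [C_mul, ← key p hp, ← key q hq, sub_self]
    exact dvd_zero F
  · refine ((hmul (p.coeff 0) (q.coeff 0)).mono_left ((Set.union_subset_union
      (M.cells_coeff_subset p 0) (M.cells_coeff_subset q 0)).trans
      (Set.subset_insert _ _))).mono_right ?_
    refine M.polyCells_subset_of_coeff fun i => ?_
    rw [coeff_C]
    split_ifs
    · exact Set.subset_insert _ _
    · exact M.cells_zero_subset _

namespace CheapRoot

variable {M} {ω : A} {L γ : ℕ} (h : M.CheapRoot ω L γ)
include h

theorem pow_three_mul : ω ^ (3 * L) = 1 := by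
  linear_combination (ω ^ L - 1) * h.root

theorem C_root : (C (ω ^ L) ^ 2 + C (ω ^ L) + 1 : A[X]) = 0 := by
  rw [← C_pow, ← pow_mul, mul_comm L, ← C_add, ← C_1, ← C_add, h.root, C_0]

theorem derives_add {p q : A[X]} {N c d e : ℕ} {S : Set R} (hp : p ∈ degreeLT A N)
    (hq : q ∈ degreeLT A N) (hc : Derives S c (M.polyCells p)) (hd : Derives S d (M.polyCells q))
    (he : c + d + N * γ ≤ e) : Derives S e (M.polyCells (p + q)) :=
  (M.derives_polyCells_add hp hq hc hd).mono_cost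
    (le_trans (by gcongr; exact h.addCost_le) he)

theorem derives_C_pow_mul {p : A[X]} {N c e : ℕ} {S : Set R} (s : ℕ) (hp : p ∈ degreeLT A N)
    (hc : Derives S c (M.polyCells p)) (he : c + N * γ ≤ e) :
    Derives S e (M.polyCells (C (ω ^ s) * p)) :=
  (M.derives_polyCells_C_mul (h.derives_pow_mul s) hp hc).mono_cost he

/-- Substituting `ω ^ e` for `X ^ N` in three blocks of length `N` takes two multiplications by
powers of `ω` and two additions per position. -/
theorem exists_reduce {p : A[X]} {N : ℕ} (e : ℕ) (hp : p ∈ degreeLT A (3 * N)) :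
    ∃ p' ∈ degreeLT A N, X ^ N - C (ω ^ e) ∣ p' - p ∧
      Derives (M.polyCells p) (4 * (N * γ)) (M.polyCells p') := by
  obtain ⟨p₀, hp₀, p', hp', rfl, h₀, h'⟩ :=
    M.exists_split (N := N) (m := N + N) (by rwa [← two_mul, ← add_comm, ← Nat.succ_mul])
  obtain ⟨p₁, hp₁, p₂, hp₂, rfl, h₁, h₂⟩ := M.exists_split hp'
  have h₁' := h₁.trans (Set.insert_subset (Set.mem_insert _ _) h')
  have h₂' := h₂.trans (Set.insert_subset (Set.mem_insert _ _) h')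
  refine ⟨p₀ + (C (ω ^ e) * p₁ + C (ω ^ (2 * e)) * p₂),
    add_mem hp₀ (add_mem (C_mul_mem_degreeLT _ hp₁) (C_mul_mem_degreeLT _ hp₂)), ?_, ?_⟩
  · refine ⟨-(p₁ + (X ^ N + C (ω ^ e)) * p₂), ?_⟩
    rw [mul_comm 2 e, pow_mul, C_pow (n := 2)]
    ring
  · exact h.derives_add hp₀ (add_mem (C_mul_mem_degreeLT _ hp₁) (C_mul_mem_degreeLT _ hp₂))
      (.refl (c := 0) h₀)
      (h.derives_add (C_mul_mem_degreeLT _ hp₁) (C_mul_mem_degreeLT _ hp₂)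
        (h.derives_C_pow_mul e hp₁ (.refl (c := 0) h₁') le_rfl)
        (h.derives_C_pow_mul (2 * e) hp₂ (.refl (c := 0) h₂') le_rfl) le_rfl) (by omega)

theorem exists_branch {p q : A[X]} {N c e : ℕ} (hm : M.MulMod (X ^ N - C (ω ^ e)) N c)
    (hp : p ∈ degreeLT A (3 * N)) (hq : q ∈ degreeLT A (3 * N)) :
    ∃ r ∈ degreeLT A N, X ^ N - C (ω ^ e) ∣ r - p * q ∧
      Derives (M.polyCells p ∪ M.polyCells q) (8 * (N * γ) + c) (M.polyCells r) := by
  obtain ⟨p', hp', hdp, hcp⟩ := h.exists_reduce e hp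
  obtain ⟨q', hq', hdq, hcq⟩ := h.exists_reduce e hq
  obtain ⟨r, hr, hdr, hcr⟩ := hm p' hp' q' hq'
  refine ⟨r, hr, ?_, ?_⟩
  · have : r - p * q = (r - p' * q') + ((p' - p) * q' + p * (q' - q)) := by ring
    rw [this]
    exact dvd_add hdr (dvd_add (hdp.mul_right _) (hdq.mul_left _))
  · refine (((hcp.mono_left ?_).union (hcq.mono_left ?_)).trans hcr).mono_cost (by omega)
    · exact Set.subset_union_left.trans (Set.subset_insert _ _)
    · exact Set.subset_union_right.trans (Set.subset_insert _ _)

theorem derives_sum_three {r₀ r₁ r₂ : A[X]} {N : ℕ} (s₀ s₁ s₂ : ℕ) (h₀ : r₀ ∈ degreeLT A N)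
    (h₁ : r₁ ∈ degreeLT A N) (h₂ : r₂ ∈ degreeLT A N) :
    Derives (M.polyCells r₀ ∪ M.polyCells r₁ ∪ M.polyCells r₂) (5 * (N * γ))
      (M.polyCells (C (ω ^ s₀) * r₀ + (C (ω ^ s₁) * r₁ + C (ω ^ s₂) * r₂))) := by
  refine h.derives_add (C_mul_mem_degreeLT _ h₀)
    (add_mem (C_mul_mem_degreeLT _ h₁) (C_mul_mem_degreeLT _ h₂))
    (h.derives_C_pow_mul s₀ h₀ (.of_subset ?_) le_rfl)
    (h.derives_add (C_mul_mem_degreeLT _ h₁) (C_mul_mem_degreeLT _ h₂)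
      (h.derives_C_pow_mul s₁ h₁ (.of_subset ?_) le_rfl)
      (h.derives_C_pow_mul s₂ h₂ (.of_subset ?_) le_rfl) le_rfl) (by omega)
  all_goals grind

/-- One butterfly: `X ^ (3 * N) - ω ^ (3 * s)` is the product of the three moduli `X ^ N - ω ^ (s +
i * L)`. The constant is `39 = 3 * 8 + 3 * 5`: reducing both factors in each branch, then three
output blocks of three multiplications by powers of `ω` and two additions each. -/
theorem mulMod_three_mul [CharP A 2] {N c s : ℕ}
    (hm : ∀ i < 3, M.MulMod (X ^ N - C (ω ^ (s + i * L))) N c) :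
    M.MulMod (X ^ (3 * N) - C (ω ^ (3 * s))) (3 * N) (3 * c + 39 * (N * γ)) := by
  intro p hp q hq
  obtain ⟨r₀, h₀, hd₀, hc₀⟩ := h.exists_branch (hm 0 (by omega)) hp hq
  obtain ⟨r₁, h₁, hd₁, hc₁⟩ := h.exists_branch (hm 1 (by omega)) hp hq
  obtain ⟨r₂, h₂, hd₂, hc₂⟩ := h.exists_branch (hm 2 (by omega)) hp hq
  obtain ⟨t, ht⟩ : ∃ t, ω ^ s * ω ^ t = 1 := by
    -- Since `ω ^ (3 * L) = 1`, this exponent stands for `-s`.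
    refine ⟨s * (3 * L - 1), ?_⟩
    rw [← pow_add, add_comm, ← Nat.mul_succ, Nat.succ_eq_add_one, Nat.sub_add_cancel (by have := h.pos; omega), mul_comm s,
      pow_mul, h.pow_three_mul, one_pow]
  -- The block at `X ^ (j * N)` of the interpolant; `t`, `t + 2 * L`, `t + L` are the exponents of
  -- the inverses of the three nodes.
  let a (j : ℕ) : A[X] := C (ω ^ (j * t)) * r₀ + (C (ω ^ (j * (t + 2 * L))) * r₁ +
    C (ω ^ (j * (t + L))) * r₂)
  have ha (j : ℕ) : a j ∈ degreeLT A N := add_mem (C_mul_mem_degreeLT _ h₀)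
    (add_mem (C_mul_mem_degreeLT _ h₁) (C_mul_mem_degreeLT _ h₂))
  refine ⟨a 0 + X ^ N * (a 1 + X ^ N * a 2), ?_, ?_, ?_⟩
  · have e : 3 * N = N + (N + N) := by ring
    rw [e]
    exact add_mem (degreeLT_mono (by omega) (ha 0)) (X_pow_mul_mem_degreeLT
      (add_mem (degreeLT_mono (by omega) (ha 1)) (X_pow_mul_mem_degreeLT (ha 2))))
  · have hT : (C (ω ^ s) * C (ω ^ t) : A[X]) = 1 := by rw [← C_mul, ht, C_1]
    have := dvd_interpolate_three (Y := X ^ N) two_eq_zero hT h.C_root (by simpa using hd₀)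
      (by simpa [pow_add] using hd₁) (by simpa [pow_add, mul_comm 2 L, pow_mul] using hd₂)
    convert this using 1
    · simp only [← C_pow, ← pow_mul, mul_comm]
    · simp only [a, pow_zero, C_pow, pow_add, pow_mul, C_mul]
      ring
  · have hc := ((hc₀.union hc₁).union hc₂).trans (((h.derives_sum_three (0 * t) (0 * (t + 2 * L))
      (0 * (t + L)) h₀ h₁ h₂).union (h.derives_sum_three (1 * t) (1 * (t + 2 * L)) (1 * (t + L))
      h₀ h₁ h₂)).union (h.derives_sum_three (2 * t) (2 * (t + 2 * L)) (2 * (t + L)) h₀ h₁ h₂))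
    refine (hc.mono_right ?_).mono_cost (by omega)
    refine (M.polyCells_join_subset (ha 0)).trans
      ((Set.union_subset_union_right _ (M.polyCells_join_subset (ha 1))).trans ?_)
    rw [← Set.union_assoc]
    exact Set.subset_insert _ _

/-- The modulus is `X ^ (3 * N) - 1` without its factor `X ^ N - 1`, so only the two primitive cube
roots of unity serve as nodes. Here `20 = 2 * 8 + 3 + 1`. -/
theorem mulMod_two_mul [CharP A 2] {N c : ℕ}
    (hm : ∀ i < 3, M.MulMod (X ^ N - C (ω ^ (i * L))) N c) :
    M.MulMod (X ^ (2 * N) + X ^ N + 1) (2 * N) (2 * c + 20 * (N * γ)) := by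
  intro p hp q hq
  have hp' := degreeLT_mono (show 2 * N ≤ 3 * N by omega) hp
  have hq' := degreeLT_mono (show 2 * N ≤ 3 * N by omega) hq
  obtain ⟨r₁, h₁, hd₁, hc₁⟩ := h.exists_branch (hm 1 (by omega)) hp' hq'
  obtain ⟨r₂, h₂, hd₂, hc₂⟩ := h.exists_branch (hm 2 (by omega)) hp' hq'
  have ha : C (ω ^ (2 * L)) * r₁ + C (ω ^ L) * r₂ ∈ degreeLT A N :=
    add_mem (C_mul_mem_degreeLT _ h₁) (C_mul_mem_degreeLT _ h₂)
  refine ⟨C (ω ^ (2 * L)) * r₁ + C (ω ^ L) * r₂ + X ^ N * (r₁ + r₂), ?_, ?_, ?_⟩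
  · rw [two_mul]
    exact add_mem (degreeLT_mono (by omega) ha) (X_pow_mul_mem_degreeLT (add_mem h₁ h₂))
  · have := dvd_interpolate_two (Y := X ^ N) two_eq_zero h.C_root (by simpa using hd₁)
      (by simpa [mul_comm 2 L, pow_mul] using hd₂)
    convert this using 1
    · rw [mul_comm 2 N, pow_mul]
    · rw [mul_comm 2 L, pow_mul, C_pow (n := 2)]
  · have hc := (hc₁.union hc₂).trans ((h.derives_add (C_mul_mem_degreeLT _ h₁)
      (C_mul_mem_degreeLT _ h₂)
      (h.derives_C_pow_mul (2 * L) h₁ (.of_subset Set.subset_union_left) le_rfl)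
      (h.derives_C_pow_mul L h₂ (.of_subset Set.subset_union_right) le_rfl) le_rfl).union
      (h.derives_add h₁ h₂ (.of_subset Set.subset_union_left)
        (.of_subset Set.subset_union_right) le_rfl))
    exact (hc.mono_right ((M.polyCells_join_subset ha).trans (Set.subset_insert _ _))).mono_cost
      (by omega)

/-- Multiplication modulo `X ^ 3 ^ j - ω ^ s` by the radix-3 fast Fourier transform. -/
theorem mulMod_pow [CharP A 2] {μ : ℕ}
    (hmul : ∀ a b, Derives (M.cells a ∪ M.cells b) μ (M.cells (a * b))) (j : ℕ) :
    ∀ s, 3 ^ j ∣ L → 3 ^ j ∣ s →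
      M.MulMod (X ^ 3 ^ j - C (ω ^ s)) (3 ^ j) (3 ^ j * (μ + 13 * (j * γ))) := by
  induction j with
  | zero =>
    intro s _ _
    simpa using M.mulMod_one _ hmul
  | succ j ih =>
    rintro s hL ⟨s, rfl⟩
    have hL' := (pow_dvd_pow 3 j.le_succ).trans hL
    -- The exponents `3 ^ j * s + i * L` are again multiples of `3 ^ j` because `3 ^ j` divides `L`;
    -- this lets the recursion extract further cube roots. The factor 13 in the cost is `39 / 3`.
    have := h.mulMod_three_mul (s := 3 ^ j * s) fun i _ =>
      ih (3 ^ j * s + i * L) hL' (dvd_add (dvd_mul_right _ _) (hL'.mul_left i))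
    convert this using 1
    · rw [pow_succ']
      ring_nf
    · rw [pow_succ']
    · rw [pow_succ']
      ring

theorem mulMod_top [CharP A 2] {μ : ℕ}
    (hmul : ∀ a b, Derives (M.cells a ∪ M.cells b) μ (M.cells (a * b))) (j : ℕ) (hL : 3 ^ j ∣ L) :
    M.MulMod (X ^ (2 * 3 ^ j) + X ^ 3 ^ j + 1) (2 * 3 ^ j)
      (3 ^ j * (2 * μ + (26 * j + 20) * γ)) := by
  convert h.mulMod_two_mul (N := 3 ^ j) (c := 3 ^ j * (μ + 13 * (j * γ))) fun i _ =>
    h.mulMod_pow hmul j (i * L) hL (hL.mul_left i) using 1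
  ring

end CheapRoot

end Repr

end BitModel

/-! ### The rings `TriRing R k` and their cheap roots of unity. -/

namespace BitModel

section TriRing

variable (R : Type*) [CommRing R]

/-- The polynomial `X ^ (2 * 3 ^ k) + X ^ 3 ^ k + 1`. -/
noncomputable def triPoly (k : ℕ) : R[X] := X ^ (2 * 3 ^ k) + X ^ 3 ^ k + 1

theorem degree_triPoly_sub (k : ℕ) : (X ^ 3 ^ k + 1 : R[X]).degree < (2 * 3 ^ k : ℕ) := by
  have h3 : 0 < 3 ^ k := by positivity
  refine (degree_add_le _ _).trans_lt (max_lt ?_ ?_)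
  · exact (degree_X_pow_le _).trans_lt (by exact_mod_cast (by omega))
  · exact degree_one_le.trans_lt (by exact_mod_cast (by omega))

theorem monic_triPoly (k : ℕ) : (triPoly R k).Monic := by
  rw [triPoly, add_assoc]
  exact monic_X_pow_add (degree_triPoly_sub R k)

theorem degree_triPoly [Nontrivial R] (k : ℕ) : (triPoly R k).degree = (2 * 3 ^ k : ℕ) := by
  rw [triPoly, add_assoc, degree_add_eq_left_of_degree_lt, degree_X_pow]
  rw [degree_X_pow]
  exact degree_triPoly_sub R k

/-- The ring `R[X] / (X ^ (2 * 3 ^ k) + X ^ 3 ^ k + 1)`. -/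
abbrev TriRing (k : ℕ) : Type _ := AdjoinRoot (triPoly R k)

variable {R} [Nontrivial R] {k : ℕ}

/-- The reduced representative of an element of `TriRing R k`. -/
noncomputable def triRep : TriRing R k →ₗ[R] R[X] := AdjoinRoot.modByMonicHom (monic_triPoly R k)

omit [Nontrivial R] in
theorem mk_triRep (a : TriRing R k) : AdjoinRoot.mk _ (triRep a) = a :=
  AdjoinRoot.mk_leftInverse (monic_triPoly R k) a

theorem triRep_mem (a : TriRing R k) : triRep a ∈ degreeLT R (2 * 3 ^ k) := by
  rw [← mk_triRep a, mem_degreeLT, ← degree_triPoly R k]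
  exact degree_modByMonic_lt _ (monic_triPoly R k)

theorem triRep_mk {p : R[X]} (hp : p ∈ degreeLT R (2 * 3 ^ k)) :
    triRep (AdjoinRoot.mk (triPoly R k) p) = p := by
  rw [mem_degreeLT, ← degree_triPoly R k] at hp
  exact (modByMonic_eq_self_iff (monic_triPoly R k)).2 hp

variable (R k) in
/-- The representation of elements of `TriRing R k` by the coefficients of reduced polynomials. -/
noncomputable def triRepr : Repr R (TriRing R k) where
  cells a := (Repr.self R).polyCells (triRep a)
  cells_zero := by
    rw [map_zero]
    exact (Repr.self R).polyCells_subset_of_coeff fun i => subset_rfl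
  addCost := 2 * 3 ^ k
  derives_add a b := by
    rw [map_add]
    exact ((Repr.self R).derives_polyCells_add (triRep_mem a) (triRep_mem b)
      (.of_subset Set.subset_union_left) (.of_subset Set.subset_union_right)).mono_cost
      (by simp [Repr.self])

theorem cells_mk {p : R[X]} (hp : p ∈ degreeLT R (2 * 3 ^ k)) :
    (triRepr R k).cells (AdjoinRoot.mk _ p) = (Repr.self R).polyCells p := by
  change (Repr.self R).polyCells (triRep _) = _
  rw [triRep_mk hp]

omit [Nontrivial R] in
theorem root_triPoly : AdjoinRoot.root (triPoly R k) ^ (2 * 3 ^ k) +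
    AdjoinRoot.root (triPoly R k) ^ 3 ^ k + 1 = 0 := by
  have : AdjoinRoot.mk (triPoly R k) (X ^ (2 * 3 ^ k) + X ^ 3 ^ k + 1) = 0 := AdjoinRoot.mk_self
  simpa only [map_add, map_pow, AdjoinRoot.mk_X, map_one] using this

variable [CharP R 2]

instance : CharP (TriRing R k) 2 := by
  refine CharTwo.of_one_ne_zero_of_two_eq_zero (fun h => ?_) ?_
  · have h1 : (1 : R[X]) ∈ degreeLT R (2 * 3 ^ k) := by
      rw [mem_degreeLT, degree_one]
      exact_mod_cast (by positivity)
    have := triRep_mk (k := k) h1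
    rw [map_one, h, map_zero] at this
    exact zero_ne_one this
  · rw [← map_ofNat (AdjoinRoot.of (triPoly R k)) 2, two_eq_zero, map_zero]

/-- In characteristic 2, `X ^ (2 * 3 ^ k) = X ^ 3 ^ k + 1`, so the top third of the coefficients is
added once to each of the two lower thirds. -/
theorem derives_cells_mk {p : R[X]} (hp : p ∈ degreeLT R (3 * 3 ^ k)) :
    Derives ((Repr.self R).polyCells p) (2 * 3 ^ k) ((triRepr R k).cells (AdjoinRoot.mk _ p)) := by
  obtain ⟨p₀, hp₀, p₁, hp₁, rfl, h₀, h₁⟩ :=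
    (Repr.self R).exists_split (N := 2 * 3 ^ k) (m := 3 ^ k) (by rwa [← Nat.succ_mul])
  have hs : p₁ + X ^ 3 ^ k * p₁ ∈ degreeLT R (2 * 3 ^ k) := by
    rw [two_mul]
    exact add_mem (degreeLT_mono (Nat.le_add_right _ _) hp₁) (X_pow_mul_mem_degreeLT hp₁)
  have : AdjoinRoot.mk (triPoly R k) (p₀ + X ^ (2 * 3 ^ k) * p₁) =
      AdjoinRoot.mk _ (p₀ + (p₁ + X ^ 3 ^ k * p₁)) := by
    have h2 : (2 : TriRing R k) = 0 := two_eq_zero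
    simp only [map_add, map_mul, map_pow, AdjoinRoot.mk_X]
    linear_combination AdjoinRoot.mk _ p₁ * root_triPoly (R := R) (k := k) -
      AdjoinRoot.mk _ p₁ * (1 + AdjoinRoot.root (triPoly R k) ^ 3 ^ k) * h2
  rw [this, cells_mk (add_mem hp₀ hs)]
  refine ((Repr.self R).derives_polyCells_add hp₀ hs (.refl (c := 0) h₀)
    (.refl (c := 0) ?_)).mono_cost (by simp [Repr.self])
  refine ((Repr.self R).polyCells_join_subset hp₁).trans ?_
  rwa [Set.union_self]

omit [Nontrivial R] [CharP R 2] in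
-- With `3 * 3 ^ k` coefficients one may compute modulo `X ^ (3 * 3 ^ k) - 1`, where multiplication
-- by `X` is a cyclic rotation and costs nothing. Reduction is postponed to a single use of
-- `derives_cells_mk`.
theorem exists_shift (s : ℕ) {p : R[X]} (hp : p ∈ degreeLT R (3 * 3 ^ k)) :
    ∃ p' ∈ degreeLT R (3 * 3 ^ k), AdjoinRoot.mk (triPoly R k) p' =
      AdjoinRoot.root (triPoly R k) ^ s * AdjoinRoot.mk (triPoly R k) p ∧
      (Repr.self R).polyCells p' ⊆ insert 0 ((Repr.self R).polyCells p) := by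
  induction s with
  | zero => exact ⟨p, hp, by simp, Set.subset_insert _ _⟩
  | succ s ih =>
    obtain ⟨p', hp', he, hc⟩ := ih
    obtain ⟨m, hm⟩ : ∃ m, 3 * 3 ^ k = m + 1 :=
      Nat.exists_eq_succ_of_ne_zero (by positivity)
    rw [hm] at hp'
    obtain ⟨p₀, hp₀, p₁, hp₁, rfl, h₀, h₁⟩ := (Repr.self R).exists_split hp'
    refine ⟨p₁ + X ^ 1 * p₀, ?_, ?_, ?_⟩
    · rw [hm, add_comm m]
      exact add_mem (degreeLT_mono (by omega) hp₁) (X_pow_mul_mem_degreeLT hp₀)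
    · have h3 : AdjoinRoot.root (triPoly R k) ^ (m + 1) = 1 := by
        rw [← hm]
        linear_combination (AdjoinRoot.root (triPoly R k) ^ 3 ^ k - 1) *
          root_triPoly (R := R) (k := k)
      rw [pow_succ' _ s, mul_assoc, ← he]
      simp only [map_add, map_mul, map_pow, AdjoinRoot.mk_X]
      linear_combination -AdjoinRoot.mk _ p₁ * h3
    · refine ((Repr.self R).polyCells_join_subset hp₁).trans (Set.union_subset ?_ ?_)
      · exact h₁.trans (Set.insert_subset (Set.mem_insert _ _) hc)
      · exact h₀.trans (Set.insert_subset (Set.mem_insert _ _) hc)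

variable (R k) in
theorem cheapRoot_root :
    (triRepr R k).CheapRoot (AdjoinRoot.root (triPoly R k)) (3 ^ k) (2 * 3 ^ k) where
  addCost_le := le_rfl
  derives_pow_mul s a := by
    obtain ⟨p, hp, he, hc⟩ := exists_shift s
      (degreeLT_mono (Nat.mul_le_mul_right _ (by omega)) (triRep_mem a))
    rw [mk_triRep] at he
    rw [← he]
    exact (derives_cells_mk hp).mono_left hc
  root := root_triPoly
  pos := by positivity

variable (R k) in
/-- Elements of `TriRing R k` can be multiplied at cost `c`. -/
def TriMul (c : ℕ) : Prop := ∀ a b : TriRing R k,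
  Derives ((triRepr R k).cells a ∪ (triRepr R k).cells b) c ((triRepr R k).cells (a * b))

omit [CharP R 2] in
theorem derives_cells_of_mul (r : R) (a : TriRing R k) :
    Derives ({r} ∪ (triRepr R k).cells a) (2 * 3 ^ k)
      ((triRepr R k).cells (AdjoinRoot.of _ r * a)) := by
  have : triRep (AdjoinRoot.of (triPoly R k) r * a) = C r * triRep a := by
    rw [← smul_eq_C_mul, ← map_smul, Algebra.smul_def]
    rfl
  change Derives _ _ ((Repr.self R).polyCells _)
  rw [this]
  refine ((Repr.self R).derives_polyCells (C_mul_mem_degreeLT r (triRep_mem a))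
    fun i _ => ?_).mono_cost (mul_one _).le
  rw [coeff_C_mul]
  refine (Derives.mul_singleton r ((triRep a).coeff i)).mono_left ?_
  exact (Set.union_subset_union_right _ ((Repr.self R).cells_coeff_subset (triRep a) i)).trans
    (Set.subset_insert _ _)

variable (R k) in
-- Base case of the recursion: for each coefficient of `a`, one shift of `b`, one scalar
-- multiplication and one addition, each of cost `2 * 3 ^ k`.
theorem triMul_schoolbook : TriMul R k (2 * 3 ^ k * (3 * (2 * 3 ^ k))) := by
  intro a b
  let t (i : ℕ) : TriRing R k := AdjoinRoot.of _ ((triRep a).coeff i) *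
    (AdjoinRoot.root (triPoly R k) ^ i * b)
  have ht (i : ℕ) : Derives ((triRepr R k).cells a ∪ (triRepr R k).cells b) (2 * (2 * 3 ^ k))
      ((triRepr R k).cells (t i)) := by
    have h1 := ((cheapRoot_root R k).derives_pow_mul i b).mono_left
      (S' := (triRepr R k).cells a ∪ (triRepr R k).cells b)
      (Set.subset_union_right.trans (Set.subset_insert _ _))
    have h2 : Derives ((triRepr R k).cells a ∪ (triRepr R k).cells b) 0
        {(triRep a).coeff i} :=
      .of_subset (((Repr.self R).cells_coeff_subset (triRep a) i).trans Set.subset_union_left)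
    exact ((h2.union h1).trans (derives_cells_of_mul _ _)).mono_cost (by omega)
  have hs (n : ℕ) : Derives ((triRepr R k).cells a ∪ (triRepr R k).cells b)
      (n * (3 * (2 * 3 ^ k))) ((triRepr R k).cells (∑ i ∈ Finset.range n, t i)) := by
    induction n with
    | zero => exact .refl (by simpa using (triRepr R k).cells_zero_subset _)
    | succ n ih =>
      rw [Finset.sum_range_succ]
      exact ((ih.union (ht n)).trans ((triRepr R k).derives_add _ _)).mono_cost
        (by simp only [triRepr]; linarith)
  have hab : a * b = ∑ i ∈ Finset.range (2 * 3 ^ k), t i := by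
    conv_lhs => rw [← mk_triRep a]
    rw [as_sum_range' (triRep a) (2 * 3 ^ k) (by
      have := mem_degreeLT.1 (triRep_mem a)
      by_cases h0 : triRep a = 0
      · rw [h0, natDegree_zero]
        positivity
      · exact (natDegree_lt_iff_degree_lt h0).2 this), map_sum, Finset.sum_mul]
    refine Finset.sum_congr rfl fun i _ => ?_
    rw [← C_mul_X_pow_eq_monomial, map_mul, map_pow, AdjoinRoot.mk_X, AdjoinRoot.mk_C, mul_assoc]
  rw [hab]
  exact hs _

end TriRing

end BitModel

/-! ### Schönhage's recursion. -/

namespace BitModel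

theorem sum_X_pow_mul_ofCoeffs {R : Type*} [CommRing R] {L : ℕ} (hL : 0 < L) (m : ℕ)
    (c : ℕ → ℕ → R) :
    ∑ i ∈ Finset.range m, (X ^ L) ^ i * ofCoeffs L (c i) =
      ofCoeffs (m * L) fun n => c (n / L) (n % L) := by
  induction m with
  | zero => simp [ofCoeffs]
  | succ m ih =>
    rw [Finset.sum_range_succ, ih, Nat.succ_mul, ofCoeffs, ofCoeffs, ofCoeffs,
      Finset.sum_range_add, Finset.mul_sum]
    congr 1
    refine Finset.sum_congr rfl fun i hi => ?_
    have hi := Finset.mem_range.1 hi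
    rw [← pow_mul, X_pow_mul_monomial, mul_comm m L, Nat.mul_add_div hL, Nat.div_eq_of_lt hi,
      Nat.mul_add_mod, Nat.mod_eq_of_lt hi, add_zero, add_comm i]

theorem ofCoeffs_coeff {A : Type*} [CommRing A] {N : ℕ} {p : A[X]} (hp : p ∈ degreeLT A N) :
    ofCoeffs N p.coeff = p := by
  ext i
  rw [coeff_ofCoeffs]
  split_ifs with hi
  · rfl
  · exact (coeff_eq_zero_of_mem_degreeLT hp (by omega)).symm

/-- The rule `X ^ (d + 2 * M) ≡ -X ^ (d + M) - X ^ d` only adds and subtracts coefficients, so they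
stay in `S`. Applied to polynomial coefficients, this keeps their degree bound during reduction. -/
theorem exists_eq_mul_add {B : Type*} [CommRing B] (S : AddSubgroup B) {M : ℕ} (hM : 0 < M)
    {f : B[X]} (hf : ∀ i, f.coeff i ∈ S) :
    ∃ q g : B[X], f = (X ^ (2 * M) + X ^ M + 1) * q + g ∧ g ∈ degreeLT B (2 * M) ∧
      ∀ i, g.coeff i ∈ S := by
  have hmon (b : B) (hb : b ∈ S) (n : ℕ) : ∃ q g : B[X],
      monomial n b = (X ^ (2 * M) + X ^ M + 1) * q + g ∧ g ∈ degreeLT B (2 * M) ∧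
      ∀ i, g.coeff i ∈ S := by
    induction n using Nat.strong_induction_on with
    | _ n ih =>
      by_cases hn : n < 2 * M
      · refine ⟨0, monomial n b, by simp, ?_, fun i => ?_⟩
        · rw [mem_degreeLT]
          exact (degree_monomial_le n b).trans_lt (by exact_mod_cast hn)
        · rw [coeff_monomial]
          split_ifs
          exacts [hb, S.zero_mem]
      · obtain ⟨d, rfl⟩ := Nat.exists_eq_add_of_le' (not_lt.1 hn)
        obtain ⟨q₁, g₁, e₁, hg₁, hS₁⟩ := ih (d + M) (by omega)
        obtain ⟨q₀, g₀, e₀, hg₀, hS₀⟩ := ih d (by omega)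
        refine ⟨monomial d b - q₁ - q₀, -g₁ - g₀, ?_, sub_mem (neg_mem hg₁) hg₀, fun i => ?_⟩
        · rw [← X_pow_mul_monomial] at e₁ ⊢
          linear_combination -e₁ - e₀
        · rw [coeff_sub, coeff_neg]
          exact sub_mem (neg_mem (hS₁ i)) (hS₀ i)
  rw [as_sum_support f]
  refine Finset.sum_induction (M := B[X]) _ (fun f => ∃ q g : B[X],
    f = (X ^ (2 * M) + X ^ M + 1) * q + g ∧ g ∈ degreeLT B (2 * M) ∧ ∀ i, g.coeff i ∈ S)
    ?_ ?_ fun i _ => hmon _ (hf i) i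
  · rintro _ _ ⟨q, g, rfl, hg, hS⟩ ⟨q', g', rfl, hg', hS'⟩
    exact ⟨q + q', g + g', by ring, add_mem hg hg', fun i => by
      rw [coeff_add]
      exact add_mem (hS i) (hS' i)⟩
  · exact ⟨0, 0, by simp, zero_mem _, fun i => by simp⟩

theorem eval_eq_sum_range_of_mem {B : Type*} [CommRing B] {N : ℕ} {g : B[X]} (x : B)
    (hg : g ∈ degreeLT B N) : g.eval x = ∑ i ∈ Finset.range N, x ^ i * g.coeff i := by
  conv_lhs => rw [← ofCoeffs_coeff hg]
  simp [ofCoeffs, eval_finsetSum, mul_comm]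

theorem eq_of_dvd_sub {A : Type*} [CommRing A] [Nontrivial A] {k : ℕ} {r g : A[X]}
    (hr : r ∈ degreeLT A (2 * 3 ^ k)) (hg : g ∈ degreeLT A (2 * 3 ^ k))
    (h : triPoly A k ∣ r - g) : r = g := by
  rw [← sub_eq_zero]
  have := mem_degreeLT.1 (sub_mem hr hg)
  rw [← degree_triPoly A k] at this
  by_contra h0
  exact (monic_triPoly A k).not_dvd_of_degree_lt h0 this h

variable {R : Type*} [CommRing R]

/-- The polynomial whose coefficients are the consecutive blocks of `L` coefficients of `p`. -/
noncomputable def blocks (m L : ℕ) (p : R[X]) : R[X][X] :=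
  ofCoeffs m fun i => ofCoeffs L fun j => p.coeff (L * i + j)

theorem eval_blocks {m L : ℕ} (hL : 0 < L) {p : R[X]} (hp : p ∈ degreeLT R (m * L)) :
    (blocks m L p).eval (X ^ L) = p := by
  rw [eval_eq_sum_range_of_mem _ (show blocks m L p ∈ degreeLT R[X] m from ofCoeffs_mem m _)]
  conv_rhs => rw [← ofCoeffs_coeff hp]
  have : (p.coeff : ℕ → R) = fun n => p.coeff (L * (n / L) + n % L) := by
    funext n
    rw [Nat.div_add_mod]
  rw [this, ← sum_X_pow_mul_ofCoeffs hL m fun i j => p.coeff (L * i + j)]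
  refine Finset.sum_congr rfl fun i hi => ?_
  rw [blocks, coeff_ofCoeffs, if_pos (Finset.mem_range.1 hi)]

theorem coeff_blocks_mem (m L i : ℕ) (p : R[X]) : (blocks m L p).coeff i ∈ degreeLT R L := by
  rw [blocks, coeff_ofCoeffs]
  split_ifs
  exacts [ofCoeffs_mem _ _, zero_mem _]

theorem mul_mem_degreeLT {N : ℕ} {p q : R[X]} (hp : p ∈ degreeLT R N) (hq : q ∈ degreeLT R N) :
    p * q ∈ degreeLT R (2 * N) := by
  rw [← ofCoeffs_coeff hp, ofCoeffs, Finset.sum_mul]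
  refine sum_mem fun i hi => ?_
  rw [← C_mul_X_pow_eq_monomial, mul_assoc]
  exact C_mul_mem_degreeLT _ (degreeLT_mono (by have := Finset.mem_range.1 hi; omega)
    (X_pow_mul_mem_degreeLT hq))

theorem coeff_blocks_mul_mem (m L i : ℕ) (p q : R[X]) :
    (blocks m L p * blocks m L q).coeff i ∈ degreeLT R (2 * L) := by
  rw [coeff_mul]
  exact sum_mem fun x _ => mul_mem_degreeLT (coeff_blocks_mem m L _ p) (coeff_blocks_mem m L _ q)

/-- Overlap-add: the evaluation at `X ^ L` of a polynomial whose coefficients have `2 * L`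
coefficients is the sum of two polynomials that are read off without arithmetic. -/
theorem exists_overlap {m L : ℕ} (hL : 0 < L) {g : R[X][X]} (hg : g ∈ degreeLT R[X] m)
    (hc : ∀ i, g.coeff i ∈ degreeLT R (2 * L)) :
    ∃ p₀ ∈ degreeLT R (m * L), ∃ p₁ ∈ degreeLT R (m * L), g.eval (X ^ L) = p₀ + X ^ L * p₁ ∧
      ∀ S : Set R, (∀ i, (Repr.self R).polyCells (g.coeff i) ⊆ S) →
        (Repr.self R).polyCells p₀ ⊆ insert 0 S ∧ (Repr.self R).polyCells p₁ ⊆ insert 0 S := by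
  refine ⟨ofCoeffs (m * L) fun n => (g.coeff (n / L)).coeff (n % L), ofCoeffs_mem _ _,
    ofCoeffs (m * L) fun n => (g.coeff (n / L)).coeff (n % L + L), ofCoeffs_mem _ _, ?_, ?_⟩
  · rw [← sum_X_pow_mul_ofCoeffs hL m fun i j => (g.coeff i).coeff j,
      ← sum_X_pow_mul_ofCoeffs hL m fun i j => (g.coeff i).coeff (j + L),
      eval_eq_sum_range_of_mem _ hg, Finset.mul_sum, ← Finset.sum_add_distrib]
    refine Finset.sum_congr rfl fun i _ => ?_
    have : g.coeff i = ofCoeffs L (fun j => (g.coeff i).coeff j) +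
        X ^ L * ofCoeffs L (fun j => (g.coeff i).coeff (j + L)) := by
      ext n
      rw [coeff_add, coeff_X_pow_mul', coeff_ofCoeffs, coeff_ofCoeffs]
      by_cases hn : n < L
      · simp [hn, not_le.2 hn]
      · rw [if_neg hn, if_pos (not_lt.1 hn), zero_add, Nat.sub_add_cancel (not_lt.1 hn)]
        split_ifs with h
        · rfl
        · exact coeff_eq_zero_of_mem_degreeLT (hc i) (by omega)
    conv_lhs => rw [this]
    ring
  · intro S hS
    constructor <;> exact Repr.polyCells_ofCoeffs_subset _ fun i _ =>
      (((Repr.self R).cells_coeff_subset _ _).trans (hS _)).trans (Set.subset_insert _ _)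

theorem map_mem_degreeLT {A B : Type*} [CommRing A] [CommRing B] (φ : A →+* B) {N : ℕ} {p : A[X]}
    (hp : p ∈ degreeLT A N) : p.map φ ∈ degreeLT B N :=
  mem_degreeLT.2 (degree_map_le.trans_lt (mem_degreeLT.1 hp))

theorem map_triPoly {A B : Type*} [CommRing A] [CommRing B] (φ : A →+* B) (k : ℕ) :
    (triPoly A k).map φ = triPoly B k := by
  simp [triPoly]

variable [Nontrivial R]

theorem polyCells_map_blocks_subset (m k : ℕ) (p : R[X]) :
    (triRepr R k).polyCells ((blocks m (3 ^ k) p).map (AdjoinRoot.mk (triPoly R k))) ⊆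
      insert 0 ((Repr.self R).polyCells p) := by
  refine Repr.polyCells_subset_of_coeff _ fun i => ?_
  rw [coeff_map, cells_mk (degreeLT_mono (by omega) (coeff_blocks_mem m _ i p)), blocks,
    coeff_ofCoeffs]
  split_ifs
  · exact Repr.polyCells_ofCoeffs_subset _ fun j _ =>
      ((Repr.self R).cells_coeff_subset p _).trans (Set.subset_insert _ _)
  · exact Repr.polyCells_subset_of_coeff _ fun j => Repr.cells_zero_subset _ _

/-- Schönhage's reduction of one multiplication in `TriRing R (a + b)` to `2 * 3 ^ a`
multiplications in `TriRing R b`. -/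
theorem triMul_add [CharP R 2] {a b μ : ℕ} (hab : a ≤ b) (hμ : TriMul R b μ) :
    TriMul R (a + b) (3 ^ a * (2 * μ) + 3 ^ (a + b) * (52 * a + 44)) := by
  intro u v
  have h3 : 0 < 3 ^ b := by positivity
  have hsize : 2 * 3 ^ a * 3 ^ b = 2 * 3 ^ (a + b) := by ring
  set P := blocks (2 * 3 ^ a) (3 ^ b) (triRep u) with hP
  set Q := blocks (2 * 3 ^ a) (3 ^ b) (triRep v) with hQ
  have hPm := map_mem_degreeLT (AdjoinRoot.mk (triPoly R b))
    (show P ∈ degreeLT R[X] (2 * 3 ^ a) from ofCoeffs_mem _ _)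
  have hQm := map_mem_degreeLT (AdjoinRoot.mk (triPoly R b))
    (show Q ∈ degreeLT R[X] (2 * 3 ^ a) from ofCoeffs_mem _ _)
  obtain ⟨r, hr, hdvd, hcost⟩ := (cheapRoot_root R b).mulMod_top hμ a (pow_dvd_pow 3 hab)
    _ hPm _ hQm
  -- The reduction is also carried out over `R[X]`. There the coefficients keep fewer than `2 * 3 ^
  -- b` terms, so they are recovered exactly from their classes in `TriRing R b`.
  obtain ⟨q, g, hPQ, hg, hgS⟩ := exists_eq_mul_add (degreeLT R (2 * 3 ^ b)).toAddSubgroup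
    (show 0 < 3 ^ a by positivity) (coeff_blocks_mul_mem (2 * 3 ^ a) (3 ^ b) · (triRep u) (triRep v))
  have hrg : r = g.map (AdjoinRoot.mk (triPoly R b)) := by
    have : Nontrivial (TriRing R b) := CharP.nontrivial_of_char_ne_one (R := TriRing R b)
      (show (2 : ℕ) ≠ 1 by norm_num)
    refine eq_of_dvd_sub hr (map_mem_degreeLT _ hg) ?_
    have e : r - g.map (AdjoinRoot.mk (triPoly R b)) = r - P.map (AdjoinRoot.mk (triPoly R b)) *
        Q.map (AdjoinRoot.mk (triPoly R b)) +
        triPoly _ a * q.map (AdjoinRoot.mk (triPoly R b)) := by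
      rw [← Polynomial.map_mul, hP, hQ, hPQ, ← triPoly, Polynomial.map_add, Polynomial.map_mul,
        map_triPoly]
      ring
    rw [e]
    exact dvd_add hdvd (dvd_mul_right _ _)
  obtain ⟨p₀, hp₀, p₁, hp₁, hev, hcells⟩ := exists_overlap h3 hg hgS
  rw [hsize] at hp₀ hp₁
  obtain ⟨hc₀, hc₁⟩ := hcells ((triRepr R b).polyCells r) fun i => by
    rw [hrg, ← cells_mk (hgS i), ← coeff_map]
    exact Repr.cells_coeff_subset _ _ _
  -- Setting `Y = X ^ 3 ^ b` turns the modulus in `Y` into `triPoly R (a + b)`, so the multiple `q`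
  -- of it disappears.
  have huv : u * v = AdjoinRoot.mk _ p₀ + AdjoinRoot.root (triPoly R (a + b)) ^ 3 ^ b *
      AdjoinRoot.mk _ p₁ := by
    have hu := eval_blocks h3 (hsize ▸ triRep_mem u)
    have hv := eval_blocks h3 (hsize ▸ triRep_mem v)
    rw [← AdjoinRoot.mk_X, ← map_pow, ← map_mul, ← map_add, ← hev, ← mk_triRep u, ← mk_triRep v,
      ← map_mul, AdjoinRoot.mk_eq_mk, ← hu, ← hv, ← eval_mul, hPQ]
    refine ⟨q.eval (X ^ 3 ^ b), ?_⟩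
    simp only [eval_add, eval_mul, eval_pow, eval_X, eval_one, triPoly, ← pow_mul]
    ring
  have h₀ : Derives ((triRepr R b).polyCells r) 0 ((triRepr R (a + b)).cells
      (AdjoinRoot.mk _ p₀)) := by
    rw [cells_mk hp₀]
    exact .refl hc₀
  have h₁ : Derives ((triRepr R b).polyCells r) 0 ((triRepr R (a + b)).cells
      (AdjoinRoot.mk _ p₁)) := by
    rw [cells_mk hp₁]
    exact .refl hc₁
  rw [huv]
  have key := (hcost.mono_left (S' := (triRepr R (a + b)).cells u ∪ (triRepr R (a + b)).cells v)
    (Set.union_subset ((polyCells_map_blocks_subset _ _ _).trans (Set.insert_subset_insert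
      Set.subset_union_left)) ((polyCells_map_blocks_subset _ _ _).trans (Set.insert_subset_insert
      Set.subset_union_right)))).trans
    ((h₀.union (h₁.trans ((cheapRoot_root R (a + b)).derives_pow_mul (3 ^ b) _))).trans
      ((triRepr R (a + b)).derives_add _ _))
  -- The transform with `γ = 2 * 3 ^ b` contributes `52 * a + 40`; the shift and the addition in
  -- overlap-add contribute 2 each.
  refine key.mono_cost (le_of_eq ?_)
  simp only [triRepr]
  ring

variable (R) in
-- After division by `3 ^ (u + 1)` the recursion reads `c(u) ≤ 2 c(u / 2) + 52 a + 44` with `a = (u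
-- + 1) / 2`. The 36 is the schoolbook cost at `u = 0`, and 140 is large enough to absorb the linear
-- term at each of the logarithmically many levels.
theorem triMul_succ [CharP R 2] (u : ℕ) :
    TriMul R (u + 1) (3 ^ (u + 1) * (36 + 140 * (u * (Nat.log 2 u + 1)))) := by
  induction u using Nat.strong_induction_on with
  | _ u ih =>
    rcases Nat.eq_zero_or_pos u with rfl | hu
    · exact triMul_schoolbook R 1
    · have h := triMul_add (a := (u + 1) / 2) (b := u / 2 + 1) (by omega)
        (ih (u / 2) (by omega))
      have e : (u + 1) / 2 + (u / 2 + 1) = u + 1 := by omega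
      rw [e] at h
      intro x y
      refine (h x y).mono_cost ?_
      have e' : 3 ^ ((u + 1) / 2) * (2 * (3 ^ (u / 2 + 1) * (36 + 140 * (u / 2 *
          (Nat.log 2 (u / 2) + 1))))) = 3 ^ (u + 1) * (2 * (36 + 140 * (u / 2 *
          (Nat.log 2 (u / 2) + 1)))) := by
        rw [show 3 ^ (u + 1) = 3 ^ ((u + 1) / 2) * 3 ^ (u / 2 + 1) by rw [← pow_add, e]]
        ring
      rw [e', ← mul_add]
      refine Nat.mul_le_mul_left _ ?_
      -- At `u = 1` the identity `log u = log (u / 2) + 1` fails, because `Nat.log 2 0 = 0`.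
      rcases Nat.lt_or_ge u 2 with hu2 | hu2
      · obtain rfl : u = 1 := by omega
        simp
      · have hlog : Nat.log 2 u = Nat.log 2 (u / 2) + 1 := by
          rw [Nat.log_div_base, Nat.sub_add_cancel (Nat.log_pos (by norm_num) hu2)]
        rw [hlog]
        generalize Nat.log 2 (u / 2) + 1 = l
        have h2 : u / 2 * 2 * l ≤ u * l := Nat.mul_le_mul_right _ (Nat.div_mul_le_self u 2)
        have h4 : u * (l + 1) = u * l + u := by ring
        have h5 : 52 * ((u + 1) / 2) ≤ 26 * (u + 1) := by omega
        rw [h4]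
        linarith

end BitModel

/-! ### From derivations to straight-line programs. -/

namespace BitModel

/-- A derivation of length `c` yields a straight-line program with at most `c` operations. -/
theorem exists_code {X : Type*} {S T : Set (X → ZMod 2)} {c : ℕ} (h : Derives S c T)
    (M : List (X → ZMod 2)) (h0 : 0 ∈ M) (hS : ∀ f ∈ S, f ∈ M) :
    ∃ code : List BitOp, code.length ≤ c ∧ ∀ f ∈ T, ∃ i, ∀ x,
      (exec (M.map fun f => f x) code).getD i 0 = f x := by
  have hget (M : List (X → ZMod 2)) (f : X → ZMod 2) (hf : f ∈ M) :
      ∃ i, ∀ x, (M.map fun f => f x).getD i 0 = f x := by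
    obtain ⟨i, hi, rfl⟩ := List.getElem_of_mem hf
    exact ⟨i, fun x => by simp [List.getD_eq_getElem?_getD, hi]⟩
  induction h generalizing M with
  | refl h =>
    refine ⟨[], Nat.zero_le _, fun f hf => hget M f ?_⟩
    rcases h hf with rfl | hf
    exacts [h0, hS f hf]
  | @add S T c a b ha hb _ ih =>
    have hmem : ∀ f ∈ insert 0 S, f ∈ M := by
      rintro f (rfl | hf)
      exacts [h0, hS f hf]
    obtain ⟨i, hi⟩ := hget M a (hmem a ha)
    obtain ⟨j, hj⟩ := hget M b (hmem b hb)
    obtain ⟨code, hlen, hcode⟩ := ih (M ++ [a + b]) (by simp [h0]) (by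
      rintro f (rfl | hf)
      · simp
      · simp [hS f hf])
    refine ⟨.add i j :: code, by simpa using hlen, fun f hf => ?_⟩
    obtain ⟨l, hl⟩ := hcode f hf
    refine ⟨l, fun x => ?_⟩
    rw [← hl x]
    simp only [exec, List.foldl_cons, BitOp.eval, hi, hj, List.map_append, List.map_cons,
      List.map_nil, Pi.add_apply]
  | @mul S T c a b ha hb _ ih =>
    have hmem : ∀ f ∈ insert 0 S, f ∈ M := by
      rintro f (rfl | hf)
      exacts [h0, hS f hf]
    obtain ⟨i, hi⟩ := hget M a (hmem a ha)
    obtain ⟨j, hj⟩ := hget M b (hmem b hb)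
    obtain ⟨code, hlen, hcode⟩ := ih (M ++ [a * b]) (by simp [h0]) (by
      rintro f (rfl | hf)
      · simp
      · simp [hS f hf])
    refine ⟨.mul i j :: code, by simpa using hlen, fun f hf => ?_⟩
    obtain ⟨l, hl⟩ := hcode f hf
    refine ⟨l, fun x => ?_⟩
    rw [← hl x]
    simp only [exec, List.foldl_cons, BitOp.eval, hi, hj, List.map_append, List.map_cons,
      List.map_nil, Pi.mul_apply]

/-- An upper bound for the number of bit operations of a multiplication of polynomials of degree
less than `n`. -/
def mulBound (n : ℕ) : ℕ :=
  1 + 3 ^ (Nat.log 3 n + 1) * (36 + 140 * (Nat.log 3 n * (Nat.log 2 (Nat.log 3 n) + 1)))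

theorem map_eval_ofCoeffs {X : Type*} {n : ℕ} (x : X) (c : ℕ → X → ZMod 2) {f : (ZMod 2)[X]}
    (hf : f.degree < n) (hc : ∀ i, c i x = f.coeff i) :
    (ofCoeffs n c).map (Pi.evalRingHom (fun _ => ZMod 2) x) = f := by
  ext i
  rw [coeff_map, coeff_ofCoeffs, ← hc]
  split_ifs with hi
  · rfl
  · rw [hc, (degree_lt_iff_coeff_zero _ _).1 hf i (by omega), map_zero]

/-- For every `n` there is a program of cost at most `mulBound n` that multiplies polynomials of
degree less than `n`. -/
theorem exists_program (n : ℕ) : ∃ P : Program, P.cost ≤ mulBound n ∧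
    ∀ f g : (ZMod 2)[X], f.degree < n → g.degree < n →
      P.run (coeffs n f ++ coeffs n g) = coeffs (2 * n - 1) (f * g) := by
  -- Elements of `R` are functions of the whole input, so addresses and operations do not depend on
  -- `f` and `g`.
  let R := (ZMod 2)[X] × (ZMod 2)[X] → ZMod 2
  let u := Nat.log 3 n
  let a (i : ℕ) : R := fun x => x.1.coeff i
  let b (i : ℕ) : R := fun x => x.2.coeff i
  have hn : n ≤ 3 ^ (u + 1) := (Nat.lt_pow_succ_log_self (by norm_num) n).le
  have hF : ofCoeffs n a ∈ degreeLT R (3 ^ (u + 1)) := degreeLT_mono hn (ofCoeffs_mem _ _)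
  have hG : ofCoeffs n b ∈ degreeLT R (3 ^ (u + 1)) := degreeLT_mono hn (ofCoeffs_mem _ _)
  have hle : 3 ^ (u + 1) ≤ 2 * 3 ^ (u + 1) := by omega
  have h := triMul_succ R u (AdjoinRoot.mk _ (ofCoeffs n a)) (AdjoinRoot.mk _ (ofCoeffs n b))
  -- The product has fewer than `2 * 3 ^ (u + 1)` coefficients, so nothing wraps around in `TriRing
  -- R (u + 1)`.
  rw [← map_mul, cells_mk (degreeLT_mono hle hF), cells_mk (degreeLT_mono hle hG),
    cells_mk (mul_mem_degreeLT hF hG)] at h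
  let I := (List.range n).map a ++ (List.range n).map b
  have hI : Derives {f | f ∈ I} (3 ^ (u + 1) * (36 + 140 * (u * (Nat.log 2 u + 1))))
      ((Repr.self R).polyCells (ofCoeffs n a * ofCoeffs n b)) := by
    refine h.mono_left (Set.union_subset ?_ ?_)
    all_goals
      refine Repr.polyCells_ofCoeffs_subset _ fun i hi => ?_
      refine Set.singleton_subset_iff.2 (Set.mem_insert_of_mem _ ?_)
      simp only [I, Set.mem_ofPred_eq, List.mem_append, List.mem_map, List.mem_range]
    · exact .inl ⟨i, hi, rfl⟩
    · exact .inr ⟨i, hi, rfl⟩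
  obtain ⟨code, hlen, hcode⟩ := exists_code hI (I ++ [0]) (by simp)
    fun f hf => List.mem_append_left _ hf
  choose! addr haddr using hcode
  -- The first operation writes the zero that `Derives` takes for free; it is the summand 1 in
  -- `mulBound`.
  refine ⟨⟨.const false :: code, (List.range (2 * n - 1)).map fun k =>
    addr ((ofCoeffs n a * ofCoeffs n b).coeff k)⟩, ?_, fun f g hf hg => ?_⟩
  · rw [Program.cost, List.length_cons, add_comm, mulBound]
    exact Nat.add_le_add_left hlen 1
  · rw [Program.run, coeffs, List.map_map]
    refine List.map_congr_left fun k _ => ?_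
    have hk := haddr _ ((Repr.self R).cells_coeff_subset (ofCoeffs n a * ofCoeffs n b) k rfl) (f, g)
    have hmem : (I ++ [0]).map (fun r : R => r (f, g)) = coeffs n f ++ coeffs n g ++ [0] := by
      simp only [I, coeffs, List.map_append, List.map_map, List.map_cons, List.map_nil]
      rfl
    rw [hmem] at hk
    have e : f * g = (ofCoeffs n a * ofCoeffs n b).map
        (Pi.evalRingHom (fun _ => ZMod 2) (f, g)) := by
      rw [Polynomial.map_mul, map_eval_ofCoeffs (f, g) a hf fun i => rfl,
        map_eval_ofCoeffs (f, g) b hg fun i => rfl]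
    rw [e, coeff_map]
    exact hk

end BitModel

/-! ### Computability: searching for a program that passes a decidable test. -/

namespace BitModel

instance : Primcodable (ZMod 2) := inferInstanceAs (Primcodable (Fin 2))

theorem primrec₂_zmod_two (f : ZMod 2 → ZMod 2 → ZMod 2) : Primrec₂ f :=
  Primrec.dom_finite _

theorem primrec_bitOp_eval : Primrec₂ fun (m : List (ZMod 2)) (o : BitOp) => o.eval m := by
  have heq : Primrec fun p : List (ZMod 2) × BitOp => BitOp.equiv p.2 :=
    Primrec.of_equiv.comp Primrec.snd
  have hconst : Primrec₂ fun (_ : List (ZMod 2) × BitOp) (b : Bool) =>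
      if b then (1 : ZMod 2) else 0 :=
    (Primrec.dom_finite fun b : Bool => if b then (1 : ZMod 2) else 0).comp Primrec.snd
  have hi : Primrec fun q : (List (ZMod 2) × BitOp) × (Bool × ℕ × ℕ) => q.1.1.getD q.2.2.1 0 :=
    (Primrec.list_getD 0).comp (Primrec.fst.comp Primrec.fst)
      (Primrec.fst.comp (Primrec.snd.comp Primrec.snd))
  have hj : Primrec fun q : (List (ZMod 2) × BitOp) × (Bool × ℕ × ℕ) => q.1.1.getD q.2.2.2 0 :=
    (Primrec.list_getD 0).comp (Primrec.fst.comp Primrec.fst)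
      (Primrec.snd.comp (Primrec.snd.comp Primrec.snd))
  have hop : Primrec₂ fun (p : List (ZMod 2) × BitOp) (q : Bool × ℕ × ℕ) =>
      bif q.1 then p.1.getD q.2.1 0 * p.1.getD q.2.2 0
      else p.1.getD q.2.1 0 + p.1.getD q.2.2 0 :=
    Primrec.cond (Primrec.fst.comp Primrec.snd) ((primrec₂_zmod_two (· * ·)).comp hi hj)
      ((primrec₂_zmod_two (· + ·)).comp hi hj)
  refine (Primrec.sumCasesOn heq hconst hop).of_eq ?_
  rintro ⟨m, b | ⟨i, j⟩ | ⟨i, j⟩⟩ <;> rfl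

theorem primrec_run : Primrec₂ Program.run := by
  have hcode : Primrec Program.code := Primrec.fst.comp (Primrec.of_equiv (e := Program.equiv))
  have hout : Primrec Program.out := Primrec.snd.comp (Primrec.of_equiv (e := Program.equiv))
  have hstep : Primrec₂ fun (_ : Program × List (ZMod 2)) (q : List (ZMod 2) × BitOp) =>
      q.1 ++ [q.2.eval q.1] :=
    Primrec.list_concat.comp (Primrec.fst.comp Primrec.snd)
      (primrec_bitOp_eval.comp (Primrec.fst.comp Primrec.snd) (Primrec.snd.comp Primrec.snd))
  have hexec : Primrec fun p : Program × List (ZMod 2) => exec p.2 p.1.code :=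
    Primrec.list_foldl (hcode.comp Primrec.fst) Primrec.snd hstep
  exact Primrec.list_map (hout.comp Primrec.fst)
    ((Primrec.list_getD 0).comp (hexec.comp Primrec.fst) Primrec.snd)

theorem primrec_cost : Primrec Program.cost :=
  Primrec.list_length.comp (Primrec.fst.comp (Primrec.of_equiv (e := Program.equiv)))

theorem primrec_pow : Primrec₂ ((· ^ ·) : ℕ → ℕ → ℕ) :=
  Primrec₂.unpaired'.1 Nat.Primrec.pow

theorem primrec_log {b : ℕ} (hb : 1 < b) : Primrec (Nat.log b) := by
  have h : PrimrecRel fun n k => b ^ k ≤ n :=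
    Primrec.nat_le.comp (primrec_pow.comp (Primrec.const b) Primrec.snd) Primrec.fst
  refine (Primrec.nat_findGreatest Primrec.id h).of_eq fun n => ?_
  rw [id_eq]
  rcases Nat.eq_zero_or_pos n with rfl | hn
  · simp
  · refine Nat.findGreatest_eq_iff.2 ⟨Nat.log_le_self b n,
      fun _ => Nat.pow_log_le_self b hn.ne', fun k hk _ hle => ?_⟩
    exact absurd (Nat.le_log_of_pow_le hb hle) (by omega)

theorem primrec_mulBound : Primrec mulBound := by
  have hl := primrec_log (b := 3) (by norm_num)
  have hl' := (primrec_log (b := 2) (by norm_num)).comp hl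
  exact Primrec.nat_add.comp (Primrec.const 1) (Primrec.nat_mul.comp
    (primrec_pow.comp (Primrec.const 3) (Primrec.succ.comp hl))
    (Primrec.nat_add.comp (Primrec.const 36) (Primrec.nat_mul.comp (Primrec.const 140)
      (Primrec.nat_mul.comp hl (Primrec.succ.comp hl')))))

/-- All lists of `n` bits. -/
def bitLists : ℕ → List (List (ZMod 2))
  | 0 => [[]]
  | n + 1 => (bitLists n).flatMap fun l => [0 :: l, 1 :: l]

theorem mem_bitLists (l : List (ZMod 2)) : l ∈ bitLists l.length := by
  induction l with
  | nil => simp [bitLists]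
  | cons b l ih =>
    refine List.mem_flatMap.2 ⟨l, ih, ?_⟩
    have hb : b = 0 ∨ b = 1 := by
      revert b
      decide
    rcases hb with rfl | rfl <;> simp

theorem length_of_mem_bitLists {n : ℕ} {l : List (ZMod 2)} (h : l ∈ bitLists n) :
    l.length = n := by
  induction n generalizing l with
  | zero => simpa [bitLists] using h
  | succ n ih =>
    obtain ⟨l', hl', hl⟩ := List.mem_flatMap.1 h
    have := ih hl'
    simp only [List.mem_cons, List.not_mem_nil, or_false] at hl
    rcases hl with rfl | rfl <;> simp [this]

theorem primrec_bitLists : Primrec bitLists := by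
  have hstep : Primrec₂ fun (_ : ℕ) (L : List (List (ZMod 2))) =>
      L.flatMap fun l => [0 :: l, 1 :: l] := by
    refine Primrec.list_flatMap Primrec.snd ?_
    have hc (b : ZMod 2) : Primrec fun q : (ℕ × List (List (ZMod 2))) × List (ZMod 2) =>
        b :: q.2 := Primrec.list_cons.comp (Primrec.const b) Primrec.snd
    exact Primrec.list_cons.comp (hc 0) (Primrec.list_cons.comp (hc 1) (Primrec.const []))
  refine (Primrec.nat_rec₁ [[]] hstep).of_eq fun n => ?_
  induction n with
  | zero => rfl
  | succ n ih => rw [bitLists, ← ih]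

/-- The schoolbook product of two polynomials with `n` coefficients each, which are given as the
list `x` of all their coefficients. -/
def schoolbook (n : ℕ) (x : List (ZMod 2)) : List (ZMod 2) :=
  (List.range (2 * n - 1)).map fun k => (List.range (k + 1)).foldl
    (fun s i => s + (x.take n).getD i 0 * (x.drop n).getD (k - i) 0) 0

theorem primrec_schoolbook : Primrec₂ schoolbook := by
  have hrange : Primrec fun p : ℕ × List (ZMod 2) => List.range (2 * p.1 - 1) :=
    Primrec.list_range.comp (Primrec.nat_sub.comp (Primrec.nat_double.comp Primrec.fst)
      (Primrec.const 1))
  have hn : Primrec fun q : ((ℕ × List (ZMod 2)) × ℕ) × (ZMod 2 × ℕ) => q.1.1.1 :=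
    Primrec.fst.comp (Primrec.fst.comp Primrec.fst)
  have hx : Primrec fun q : ((ℕ × List (ZMod 2)) × ℕ) × (ZMod 2 × ℕ) => q.1.1.2 :=
    Primrec.snd.comp (Primrec.fst.comp Primrec.fst)
  have hi : Primrec fun q : ((ℕ × List (ZMod 2)) × ℕ) × (ZMod 2 × ℕ) => q.2.2 :=
    Primrec.snd.comp Primrec.snd
  have hstep : Primrec₂ fun (p : (ℕ × List (ZMod 2)) × ℕ) (q : ZMod 2 × ℕ) =>
      q.1 + (p.1.2.take p.1.1).getD q.2 0 * (p.1.2.drop p.1.1).getD (p.2 - q.2) 0 :=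
    (primrec₂_zmod_two (· + ·)).comp (Primrec.fst.comp Primrec.snd) ((primrec₂_zmod_two (· * ·)).comp
      ((Primrec.list_getD 0).comp (Primrec.list_take.comp hn hx) hi)
      ((Primrec.list_getD 0).comp (Primrec.list_drop.comp hn hx)
        (Primrec.nat_sub.comp (Primrec.snd.comp Primrec.fst) hi)))
  have hcoeff : Primrec fun p : (ℕ × List (ZMod 2)) × ℕ => (List.range (p.2 + 1)).foldl
      (fun s i => s + (p.1.2.take p.1.1).getD i 0 * (p.1.2.drop p.1.1).getD (p.2 - i) 0) 0 :=
    Primrec.list_foldl (Primrec.list_range.comp (Primrec.succ.comp Primrec.snd))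
      (Primrec.const 0) hstep
  exact Primrec.list_map hrange hcoeff

theorem getD_coeffs {n : ℕ} {f : (ZMod 2)[X]} (hf : f.degree < n) (i : ℕ) :
    (coeffs n f).getD i 0 = f.coeff i := by
  rw [coeffs, List.getD_eq_getElem?_getD, List.getElem?_map]
  by_cases hi : i < n
  · simp [hi]
  · rw [(degree_lt_iff_coeff_zero _ _).1 hf i (by omega)]
    simp [hi]

theorem foldl_add_eq_sum {A : Type*} [AddCommMonoid A] (F : ℕ → A) (n : ℕ) :
    (List.range n).foldl (fun s i => s + F i) 0 = ∑ i ∈ Finset.range n, F i := by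
  induction n with
  | zero => rfl
  | succ n ih => rw [List.range_succ, List.foldl_append, ih, Finset.sum_range_succ]; rfl

theorem schoolbook_coeffs {n : ℕ} {f g : (ZMod 2)[X]} (hf : f.degree < n) (hg : g.degree < n) :
    schoolbook n (coeffs n f ++ coeffs n g) = coeffs (2 * n - 1) (f * g) := by
  refine List.map_congr_left fun k _ => ?_
  have hlen : (coeffs n f).length = n := by simp [coeffs]
  rw [List.take_left' hlen, List.drop_left' hlen, foldl_add_eq_sum, coeff_mul,
    Finset.Nat.sum_antidiagonal_eq_sum_range_succ_mk]
  exact Finset.sum_congr rfl fun i _ => by rw [getD_coeffs hf, getD_coeffs hg]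

theorem exists_eq_coeffs {n : ℕ} {l : List (ZMod 2)} (h : l.length = n) :
    ∃ f : (ZMod 2)[X], f.degree < n ∧ coeffs n f = l := by
  refine ⟨ofCoeffs n fun i => l.getD i 0, mem_degreeLT.1 (ofCoeffs_mem _ _),
    List.ext_getElem (by simp [coeffs, h]) fun i hi hi' => ?_⟩
  simp only [coeffs, List.getElem_map, List.getElem_range, coeff_ofCoeffs]
  rw [if_pos (h ▸ hi'), List.getD_eq_getElem _ _ hi']

/-- The program `P` multiplies polynomials of degree less than `n` correctly, and its cost does
not exceed `mulBound n`. -/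
def IsFastMultiplier (n : ℕ) (P : Program) : Prop :=
  P.cost ≤ mulBound n ∧ ∀ x ∈ bitLists (2 * n), P.run x = schoolbook n x

/-- The test mentions only finitely many bit lists and the schoolbook product, never polynomials;
this is what makes it primitive recursive. -/
theorem primrecRel_isFastMultiplier : PrimrecRel IsFastMultiplier := by
  refine PrimrecPred.and (Primrec.nat_le.comp (primrec_cost.comp Primrec.snd)
    (primrec_mulBound.comp Primrec.fst)) ?_
  have h : PrimrecRel fun (x : List (ZMod 2)) (p : ℕ × Program) =>
      p.2.run x = schoolbook p.1 x :=
    Primrec.eq.comp (primrec_run.comp (Primrec.snd.comp Primrec.snd) Primrec.fst)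
      (primrec_schoolbook.comp (Primrec.fst.comp Primrec.snd) Primrec.fst)
  exact h.forall_mem_list.comp (primrec_bitLists.comp (Primrec.nat_double.comp Primrec.fst))
    Primrec.id

theorem IsFastMultiplier.run_eq {n : ℕ} {P : Program} (h : IsFastMultiplier n P)
    {f g : (ZMod 2)[X]} (hf : f.degree < n) (hg : g.degree < n) :
    P.run (coeffs n f ++ coeffs n g) = coeffs (2 * n - 1) (f * g) := by
  rw [← schoolbook_coeffs hf hg]
  refine h.2 _ ?_
  convert mem_bitLists (coeffs n f ++ coeffs n g) using 1
  simp [coeffs, two_mul]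

theorem exists_isFastMultiplier (n : ℕ) : ∃ P, IsFastMultiplier n P := by
  obtain ⟨P, hcost, hrun⟩ := exists_program n
  refine ⟨P, hcost, fun x hx => ?_⟩
  have hlen := length_of_mem_bitLists hx
  obtain ⟨f, hf, hf'⟩ := exists_eq_coeffs (n := n) (l := x.take n) (by simp [hlen]; omega)
  obtain ⟨g, hg, hg'⟩ := exists_eq_coeffs (n := n) (l := x.drop n) (by simp [hlen]; omega)
  rw [← List.take_append_drop n x, ← hf', ← hg', hrun f g hf hg, schoolbook_coeffs hf hg]

/-- A primitive recursive relation that has a solution for every `n` has a computable solution. -/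
theorem exists_computable_of_primrecRel {α β : Type*} [Primcodable α] [Primcodable β]
    {r : α → β → Prop} (hr : PrimrecRel r) (hex : ∀ a, ∃ b, r a b) :
    ∃ f : α → β, Computable f ∧ ∀ a, r a (f a) := by
  classical
  let s (a : α) (e : ℕ) : Option β := (Encodable.decode e).bind fun b =>
    if r a b then some b else none
  have hs : Primrec₂ s := Primrec.option_bind (Primrec.decode.comp Primrec.snd)
    (Primrec.ite (hr.comp (Primrec.fst.comp Primrec.fst) Primrec.snd)
      (Primrec.option_some.comp Primrec.snd) (Primrec.const none))
  have hp : Partrec fun a => Nat.rfindOpt (s a) := Partrec.rfindOpt hs.to_comp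
  have hdom (a : α) : (Nat.rfindOpt (s a)).Dom := by
    obtain ⟨b, hb⟩ := hex a
    exact Nat.rfindOpt_dom.2 ⟨Encodable.encode b, b, by simp [s, hb]⟩
  refine ⟨fun a => (Nat.rfindOpt (s a)).get (hdom a),
    hp.of_eq fun a => (Part.some_get (hdom a)).symm, fun a => ?_⟩
  obtain ⟨e, he⟩ := Nat.rfindOpt_spec (Part.get_mem (hdom a))
  obtain ⟨b, _, hb⟩ := Option.bind_eq_some_iff.1 he
  split_ifs at hb with h
  exact (congrArg (r a) (Option.some.inj hb)).mp h

/-! ### The asymptotic bound and the conclusion. -/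

theorem mulBound_isBigO : (fun n : ℕ => (mulBound n : ℝ)) =O[atTop]
    (fun n : ℕ => (n : ℝ) * Real.log n * (Real.log (Real.log n)) ^ 2) := by
  have hlog : Tendsto (fun n : ℕ => Real.log n) atTop atTop :=
    Real.tendsto_log_atTop.comp tendsto_natCast_atTop_atTop
  -- `1369 = 1 + 3 * (36 + 140 * 3)`.
  refine IsBigO.of_bound 1369 ?_
  filter_upwards [eventually_ge_atTop 1, hlog.eventually_ge_atTop 1,
    (Real.tendsto_log_atTop.comp hlog).eventually_ge_atTop 1] with n hn hl hll
  simp only [Function.comp_apply] at hll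
  have hn0 : n ≠ 0 := by omega
  have hn' : (1 : ℝ) ≤ n := by exact_mod_cast hn
  set l := Real.log n
  set m := Real.log l
  have hu : (Nat.log 3 n : ℝ) ≤ l := by
    have h : ((3 : ℝ) ^ Nat.log 3 n) ≤ n := by exact_mod_cast Nat.pow_log_le_self 3 hn0
    have h3 : 1 ≤ Real.log 3 :=
      (Real.le_log_iff_exp_le (by norm_num)).2 Real.exp_one_lt_three.le
    have := Real.log_le_log (by positivity) h
    rw [Real.log_pow] at this
    nlinarith [(Nat.cast_nonneg (Nat.log 3 n) : (0 : ℝ) ≤ _)]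
  have hv : (Nat.log 2 (Nat.log 3 n) : ℝ) ≤ 2 * m := by
    rcases Nat.eq_zero_or_pos (Nat.log 3 n) with h0 | h0
    · rw [h0, Nat.log_zero_right, Nat.cast_zero]
      linarith
    · have h : ((2 : ℝ) ^ Nat.log 2 (Nat.log 3 n)) ≤ l :=
        le_trans (by exact_mod_cast Nat.pow_log_le_self 2 h0.ne') hu
      have := Real.log_le_log (by positivity) h
      rw [Real.log_pow] at this
      nlinarith [(Nat.cast_nonneg (Nat.log 2 (Nat.log 3 n)) : (0 : ℝ) ≤ _), Real.log_two_gt_d9]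
  have hp : ((3 : ℝ) ^ (Nat.log 3 n + 1)) ≤ 3 * n := by
    rw [pow_succ']
    exact mul_le_mul_of_nonneg_left (by exact_mod_cast Nat.pow_log_le_self 3 hn0) (by norm_num)
  -- Here the spare factor `log log n` is given away.
  have hm2 : m ≤ m ^ 2 := by nlinarith
  have h1 : 1 ≤ l * m ^ 2 := one_le_mul_of_one_le_of_one_le hl (hll.trans hm2)
  have h2 : l * (2 * m + 1) ≤ 3 * (l * m ^ 2) := by
    have : l * (2 * m + 1) ≤ l * (3 * m ^ 2) :=
      mul_le_mul_of_nonneg_left (by linarith) (by linarith)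
    linarith
  have h3 : 1 ≤ n * (l * m ^ 2) := one_le_mul_of_one_le_of_one_le hn' h1
  rw [Real.norm_natCast, Real.norm_of_nonneg (by positivity), mulBound]
  push_cast
  calc (1 : ℝ) + 3 ^ (Nat.log 3 n + 1) *
        (36 + 140 * (Nat.log 3 n * (Nat.log 2 (Nat.log 3 n) + 1)))
      ≤ 1 + 3 * n * (36 + 140 * (l * (2 * m + 1))) := by gcongr
    _ ≤ n * (l * m ^ 2) + 3 * n * (36 * (l * m ^ 2) + 140 * (3 * (l * m ^ 2))) := by
        gcongr
        linarith
    _ = 1369 * (n * l * m ^ 2) := by ring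

end BitModel

theorem theorem1p1 :
    ∃ A : BitModel.Algorithm, A.MultipliesPolynomials ∧
      (fun n : ℕ => (A.bitOps n : ℝ)) =O[atTop]
        (fun n : ℕ => (n : ℝ) * Real.log n * (Real.log (Real.log n)) ^ 2) := by
  obtain ⟨prog, hprog, hfast⟩ := BitModel.exists_computable_of_primrecRel
    BitModel.primrecRel_isFastMultiplier BitModel.exists_isFastMultiplier
  refine ⟨⟨prog, hprog⟩, fun n f g hf hg => (hfast n).run_eq hf hg, ?_⟩
  refine (isBigO_of_le _ fun n => ?_).trans BitModel.mulBound_isBigO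
  rw [Real.norm_natCast, Real.norm_natCast]
  exact_mod_cast (hfast n).1
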